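/- Let $L=(L_t)_{t\ge 0}$ be a real-valued Lévy process, and let $\Psi$ be its characteristic exponent, i.e. the continuous function with $\Psi(0)=0$ and $\mathbb E[e^{i\xi L_1}]=e^{\Psi(\xi)}$ for all $\xi\in\mathbb R$. Assume: 1. $L$ is locally symmetric and self-similar: for some $H\in\mathbb R$, the rescaled processes $(a^H L_{t/a})_{t\ge 0}$ converge in law (in the sense of finite-dimensional distributions), as $a\to\infty$, to a symmetric random process that is not almost surely zero at all times; 2. the Blumenthal–Getoor index $\beta=\inf\{p>0 : |\Psi(\xi)|/|\xi|^p\to 0 \text{ as } |\xi|\to\infty\}$ of $L$ belongs to $(0,2]$; 3. $\mathbb E[|L_1|^p]<\infty$ for some $p>0$. For a real random variable $X$ with Lebesgue density $f$, write $h(X)=-\int_{\mathbb R} f\log f\,\mathrm dx$, and call $h(X)$ finite if $X$ is absolutely continuous and $f\log f$ is Lebesgue integrable. Then $h(L_t)$ is finite for every $t>0$. Moreover, as $t\to0^+$, $t^{-1/\beta}L_t$ converges in law to a symmetric $\beta$-stable random variable $Y_\beta$, that is, one with characteristic function $\xi\mapsto\exp(-\gamma|\xi|^\beta)$ for some $\gamma>0$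 (determined by $L$); $h(Y_\beta)$ is finite; and $$h(L_t)=\frac1\beta\log t+h(Y_\beta)+o(1)\qquad\text{as } t\to0^+ .$$ -/

import Mathlib

open MeasureTheory ProbabilityTheory Filter Topology
open scoped NNReal

namespace LevyEntropy

/-- A real-valued Lévy process `(L t)_{t ≥ 0}`: it starts at `0`, has stationary and independent
increments, and almost surely càdlàg sample paths. -/
structure IsLevyProcess {Ω : Type*} [MeasurableSpace Ω] (L : ℝ≥0 → Ω → ℝ) (P : Measure Ω) :
    Prop where
  measurable : ∀ t, Measurable (L t)
  zero : L 0 =ᵐ[P] 0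
  stationary : ∀ s t : ℝ≥0, IdentDistrib (L s) (fun ω => L (t + s) ω - L t ω) P P
  indep : HasIndepIncrements L P
  cadlag : ∀ᵐ ω ∂P, ∀ t : ℝ≥0,
    ContinuousWithinAt (fun s => L s ω) (Set.Ici t) t ∧
      ∃ l : ℝ, Tendsto (fun s => L s ω) (𝓝[<] t) (𝓝 l)

/-- `Ψ` is the characteristic exponent of the law `μ`: the continuous function with `Ψ 0 = 0` and
`exp (Ψ ξ) = ∫ exp (i ξ x) dμ(x)`. -/
structure IsCharExponent (μ : Measure ℝ) (Ψ : ℝ → ℂ) : Prop where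
  continuous : Continuous Ψ
  zero : Ψ 0 = 0
  exp_eq : ∀ ξ : ℝ, Complex.exp (Ψ ξ) = charFun μ ξ

/-- The characteristic exponent is unique. -/
theorem IsCharExponent.unique {μ : Measure ℝ} {Ψ Ψ' : ℝ → ℂ} (h : IsCharExponent μ Ψ)
    (h' : IsCharExponent μ Ψ') : Ψ = Ψ' := by
  have key : ∀ ξ, ∃ n : ℤ, Ψ ξ = Ψ' ξ + n * (2 * Real.pi * Complex.I) := fun ξ =>
    Complex.exp_eq_exp_iff_exists_int.1 ((h.exp_eq ξ).trans (h'.exp_eq ξ).symm)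
  choose n hn using key
  have hI : (2 * Real.pi * Complex.I : ℂ) ≠ 0 := Complex.two_pi_I_ne_zero
  have hcont : Continuous (fun ξ => ((n ξ : ℝ))) := by
    have h1 : Continuous (fun ξ => ((Ψ ξ - Ψ' ξ) / (2 * Real.pi * Complex.I)).re) :=
      Complex.continuous_re.comp ((h.continuous.sub h'.continuous).div_const _)
    refine h1.congr fun ξ => ?_
    rw [hn ξ, add_sub_cancel_left, mul_div_cancel_right₀ _ hI]
    simp
  have hn' : Continuous n := Int.isClosedEmbedding_coe_real.isEmbedding.continuous_iff.2 hcont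
  have h0 : n 0 = 0 := by
    have := hn 0
    rw [h.zero, h'.zero, zero_add] at this
    have := (mul_eq_zero.1 this.symm).resolve_right hI
    exact_mod_cast this
  funext ξ
  have : n ξ = n 0 := PreconnectedSpace.constant inferInstance hn'
  rw [hn ξ, this, h0]
  simp

open Classical in
/-- The characteristic exponent of the law `μ` on `ℝ` (for `μ` infinitely divisible it exists and is
unique; otherwise the default value is `0`). -/
noncomputable def charExponent (μ : Measure ℝ) : ℝ → ℂ :=
  if h : ∃ Ψ, IsCharExponent μ Ψ then h.choose else 0

theorem IsCharExponent.charExponent_eq {μ : Measure ℝ} {Ψ : ℝ → ℂ} (h : IsCharExponent μ Ψ) :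
    charExponent μ = Ψ := by
  have hex : ∃ Ψ, IsCharExponent μ Ψ := ⟨Ψ, h⟩
  unfold charExponent
  rw [dif_pos hex]
  exact hex.choose_spec.unique h

/-- The Blumenthal–Getoor index `inf {p > 0 : |Ψ(ξ)| / |ξ|^p → 0 as |ξ| → ∞}` of a Lévy process,
where `Ψ` is the characteristic exponent of the law of `L 1`. -/
noncomputable def bgIndex {Ω : Type*} [MeasurableSpace Ω] (L : ℝ≥0 → Ω → ℝ) (P : Measure Ω) : ℝ :=
  sInf {p : ℝ | 0 < p ∧
    Tendsto (fun ξ : ℝ => ‖charExponent (P.map (L 1)) ξ‖ / |ξ| ^ p) (cocompact ℝ) (𝓝 0)}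

/-- The rescaled process `a^H X_{· / a}`. -/
noncomputable def rescale {Ω : Type*} (H : ℝ) (X : ℝ≥0 → Ω → ℝ) (a : ℝ≥0) : ℝ≥0 → Ω → ℝ :=
  fun t ω => (a : ℝ) ^ H * X (t / a) ω

/-- Convergence in law of processes, in the sense of finite-dimensional distributions. -/
def TendstoInLaw {ι Ω Ω' : Type*} [MeasurableSpace Ω] [MeasurableSpace Ω']
    (X : ι → ℝ≥0 → Ω → ℝ) (l : Filter ι) (Y : ℝ≥0 → Ω' → ℝ)
    (P : Measure Ω) [IsProbabilityMeasure P] (P' : Measure Ω') [IsProbabilityMeasure P'] : Prop :=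
  ∀ I : Finset ℝ≥0, TendstoInDistribution (fun i ω (t : I) => X i t ω) l
    (fun ω (t : I) => Y t ω) (fun _ => P) P'

/-- A process is symmetric if `Y` and `-Y` have the same law on `ℝ^[0,∞)`. -/
def IsSymmetricProcess {Ω : Type*} [MeasurableSpace Ω] (Y : ℝ≥0 → Ω → ℝ) (P : Measure Ω) : Prop :=
  IdentDistrib (fun ω t => Y t ω) (fun ω t => -Y t ω) P P

/-- A process is non-trivial if it is not (a version of) the zero process. -/
def IsNontrivialProcess {Ω : Type*} [MeasurableSpace Ω] (Y : ℝ≥0 → Ω → ℝ) (P : Measure Ω) : Prop :=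
  ∃ t, ¬ (Y t =ᵐ[P] 0)

/-- `X` is locally symmetric and self-similar: for some `H`, the rescaled processes `a^H X_{· / a}`
converge in law, as `a → ∞`, to a non-trivial symmetric process `Y`. The limit process is realized,
without loss of generality, as the coordinate process on `ℝ^[0,∞)` under its law `ν`. -/
def IsLSS {Ω : Type*} [MeasurableSpace Ω] (X : ℝ≥0 → Ω → ℝ) (P : Measure Ω)
    [IsProbabilityMeasure P] : Prop :=
  ∃ (H : ℝ) (ν : Measure (ℝ≥0 → ℝ)) (_ : IsProbabilityMeasure ν),
    TendstoInLaw (rescale H X) atTop (fun t y => y t) P ν ∧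
      IsSymmetricProcess (fun (t : ℝ≥0) (y : ℝ≥0 → ℝ) => y t) ν ∧
      IsNontrivialProcess (fun (t : ℝ≥0) (y : ℝ≥0 → ℝ) => y t) ν

/-- `μ` is a symmetric `α`-stable law with scale parameter `γ`, i.e. its characteristic function is
`exp (-γ |ξ|^α)` with `0 < α ≤ 2` and `γ > 0`. -/
structure IsSymmetricStable (α γ : ℝ) (μ : Measure ℝ) : Prop where
  prob : IsProbabilityMeasure μ
  index_pos : 0 < α
  index_le : α ≤ 2
  scale_pos : 0 < γ
  charFun_eq : ∀ ξ : ℝ, charFun μ ξ = Complex.exp ((-γ * |ξ| ^ α : ℝ) : ℂ)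

/-- The differential entropy `-∫ p log p` of a law with Lebesgue density `p`. -/
noncomputable def diffEntropy (μ : Measure ℝ) : ℝ :=
  ∫ x, Real.negMulLog ((μ.rnDeriv volume x).toReal)

/-- The law is absolutely continuous and the integrand of its differential entropy is absolutely
integrable. -/
def HasFiniteDiffEntropy (μ : Measure ℝ) : Prop :=
  μ ≪ volume ∧ Integrable (fun x => Real.negMulLog ((μ.rnDeriv volume x).toReal))

end LevyEntropy

/-! The marginal `L t` has characteristic function `exp (t Ψ)` (`IsLevyProcess.charFun_eq`), so
everything is read off `Ψ`. Local self-similarity says that `exp ((t / a) Ψ (a ^ H ξ))` converges as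
`a → ∞`, and symmetry makes the limit real. Replacing `a` by `a c` shows that the modulus `m` of the
limit at time 1 satisfies `m (c ^ H ξ) = m ξ ^ c`, so `m ξ = exp (-γ |ξ| ^ (1 / H))`. Removing the
phase ambiguity then gives `Ψ ξ ~ -γ |ξ| ^ (1 / H)` at infinity (`exists_tendsto_div_rpow`). Hence
the Blumenthal–Getoor index is `1 / H`, and `t ^ (-1/β) L t` converges to the symmetric `β`-stable
law.

Convergence in law does not control entropy, so uniform bounds are added. The decay of `Re Ψ`
dominates the characteristic functions of the rescaled marginals by one integrable function: Fourier
inversion gives uniformly bounded densities that converge pointwise. The moment hypothesis makes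
these characteristic functions uniformly Hölder at `0`, which gives uniform fractional moments and
uniformly small tails of `f log f`. Together these yield convergence of the entropies
(`tendsto_diffEntropy`), and the scaling rule `h(cX) = h(X) + log c` turns it into the logarithmic
expansion. -/

namespace LevyEntropy

/-! ### Fourier inversion for measures with integrable characteristic function. -/

/-- Fubini's theorem for an integral against a Fourier kernel. -/
theorem integral_cexp_mul_swap {μ ν : Measure ℝ} [SFinite μ] [SFinite ν] {f g : ℝ → ℂ}
    (hf : Integrable f μ) (hg : Integrable g ν) (c : ℝ) :
    ∫ x, f x * (∫ y, Complex.exp ((c * x * y : ℝ) * Complex.I) * g y ∂ν) ∂μ =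
      ∫ y, g y * (∫ x, Complex.exp ((c * x * y : ℝ) * Complex.I) * f x ∂μ) ∂ν := by
  have h : Integrable (Function.uncurry fun x y : ℝ =>
      Complex.exp ((c * x * y : ℝ) * Complex.I) * (f x * g y)) (μ.prod ν) := by
    refine (hf.mul_prod hg).bdd_mul (c := 1) ?_ ?_
    · exact Continuous.aestronglyMeasurable (by fun_prop)
    · exact Eventually.of_forall fun z => by rw [Complex.norm_exp_ofReal_mul_I]
  calc
    _ = ∫ x, ∫ y, Complex.exp ((c * x * y : ℝ) * Complex.I) * (f x * g y) ∂ν ∂μ := by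
      refine integral_congr_ae (Eventually.of_forall fun x => ?_)
      simp only [← integral_const_mul]
      exact integral_congr_ae (Eventually.of_forall fun y => by ring)
    _ = ∫ y, ∫ x, Complex.exp ((c * x * y : ℝ) * Complex.I) * (f x * g y) ∂μ ∂ν :=
      integral_integral_swap h
    _ = _ := by
      refine integral_congr_ae (Eventually.of_forall fun x => ?_)
      simp only [← integral_const_mul]
      exact integral_congr_ae (Eventually.of_forall fun y => by ring)

/-- The inverse Fourier transform of the characteristic function of `μ`. -/
noncomputable def invCharFun (μ : Measure ℝ) (x : ℝ) : ℂ :=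
  (2 * Real.pi)⁻¹ * ∫ ξ : ℝ, Complex.exp ((-x * ξ : ℝ) * Complex.I) * charFun μ ξ

/-- The density of a law with integrable characteristic function, given by Fourier inversion. -/
noncomputable def charDensity (μ : Measure ℝ) (x : ℝ) : ℝ := (invCharFun μ x).re

/-- Substituting `2πξ` for `ξ` absorbs the prefactor and matches the normalization of `𝓕`. -/
theorem invCharFun_eq (μ : Measure ℝ) (x : ℝ) :
    invCharFun μ x =
      ∫ ξ : ℝ, Complex.exp ((-(2 * Real.pi) * x * ξ : ℝ) * Complex.I) *
        charFun μ (2 * Real.pi * ξ) := by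
  have h := Measure.integral_comp_mul_left
    (fun ξ : ℝ => Complex.exp ((-x * ξ : ℝ) * Complex.I) * charFun μ ξ) (2 * Real.pi)
  rw [abs_of_pos (by positivity)] at h
  rw [invCharFun]
  rw [← Complex.real_smul, ← h]
  refine integral_congr_ae (Eventually.of_forall fun y => ?_)
  simp only
  congr 4
  ring

theorem continuous_invCharFun {μ : Measure ℝ} (hμ : Integrable (charFun μ)) :
    Continuous (invCharFun μ) := by
  refine continuous_const.mul ?_
  refine continuous_of_dominated (bound := fun ξ => ‖charFun μ ξ‖) (fun x => ?_) (fun x => ?_)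
    hμ.norm ?_
  · exact (Continuous.aestronglyMeasurable (by fun_prop)).mul hμ.aestronglyMeasurable
  · exact Eventually.of_forall fun z => by rw [norm_mul, Complex.norm_exp_ofReal_mul_I, one_mul]
  · exact Eventually.of_forall fun z => by fun_prop

theorem continuous_charDensity {μ : Measure ℝ} (hμ : Integrable (charFun μ)) :
    Continuous (charDensity μ) :=
  Complex.continuous_re.comp (continuous_invCharFun hμ)

theorem norm_invCharFun_le {μ : Measure ℝ} {G : ℝ → ℝ} (hG : Integrable G)
    (h : ∀ ξ, ‖charFun μ ξ‖ ≤ G ξ) (x : ℝ) : ‖invCharFun μ x‖ ≤ ∫ ξ, G ξ := by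
  have h1 : ‖∫ ξ : ℝ, Complex.exp ((-x * ξ : ℝ) * Complex.I) * charFun μ ξ‖ ≤ ∫ ξ, G ξ := by
    refine norm_integral_le_of_norm_le hG (Eventually.of_forall fun ξ => ?_)
    rw [norm_mul, Complex.norm_exp_ofReal_mul_I, one_mul]
    exact h ξ
  have h2 : ‖(((2 * Real.pi)⁻¹ : ℝ) : ℂ)‖ ≤ 1 := by
    rw [Complex.norm_real, Real.norm_of_nonneg (by positivity)]
    exact inv_le_one_of_one_le₀ (by linarith [Real.pi_gt_three])
  rw [invCharFun, norm_mul]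
  calc _ ≤ 1 * ∫ ξ, G ξ := mul_le_mul h2 h1 (norm_nonneg _) zero_le_one
    _ = _ := one_mul _

theorem tendsto_charDensity {ι : Type*} {l : Filter ι} [l.IsCountablyGenerated]
    {μ : ι → Measure ℝ} [∀ i, IsFiniteMeasure (μ i)] {ν : Measure ℝ} {G : ℝ → ℝ}
    (hG : Integrable G) (hμ : ∀ᶠ i in l, ∀ ξ, ‖charFun (μ i) ξ‖ ≤ G ξ)
    (hlim : ∀ ξ, Tendsto (fun i => charFun (μ i) ξ) l (𝓝 (charFun ν ξ))) (x : ℝ) :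
    Tendsto (fun i => charDensity (μ i) x) l (𝓝 (charDensity ν x)) := by
  refine (Complex.continuous_re.tendsto _).comp (Tendsto.const_mul _ ?_)
  refine tendsto_integral_filter_of_dominated_convergence G ?_ ?_ hG ?_
  · exact Eventually.of_forall fun i =>
      ((Continuous.measurable (by fun_prop)).mul measurable_charFun).aestronglyMeasurable
  · filter_upwards [hμ] with i hi
    refine Eventually.of_forall fun ξ => ?_
    rw [norm_mul, Complex.norm_exp_ofReal_mul_I, one_mul]
    exact hi ξ
  · exact Eventually.of_forall fun ξ => (hlim ξ).const_mul _

-- This is Parseval: expand `g` as the inverse transform of `𝓕 g` and apply Fubini twice, first to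
-- pair `𝓕 g` with `charFun μ`, then to move the transform from `g` onto `charFun μ`.
open FourierTransform SchwartzMap in
theorem integral_schwartz_eq {μ : Measure ℝ} [IsFiniteMeasure μ] (hμ : Integrable (charFun μ))
    (g : 𝓢(ℝ, ℂ)) : ∫ x, g x ∂μ = ∫ x, g x * invCharFun μ x := by
  have hg : 𝓕⁻ (𝓕 g) = g := by simp
  have hinv : ∀ x, g x =
      ∫ v : ℝ, Complex.exp ((2 * Real.pi * x * v : ℝ) * Complex.I) * (𝓕 g) v := by
    intro x
    conv_lhs => rw [← hg]
    rw [SchwartzMap.fourierInv_coe, Real.fourierInv_eq']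
    refine integral_congr_ae (Eventually.of_forall fun v => ?_)
    simp only [smul_eq_mul, RCLike.inner_apply, conj_trivial]
    congr 4
    ring
  have hfour : ∀ v, (𝓕 g) v =
      ∫ y : ℝ, Complex.exp ((-(2 * Real.pi) * v * y : ℝ) * Complex.I) * g y := by
    intro v
    rw [SchwartzMap.fourier_coe, Real.fourier_eq']
    refine integral_congr_ae (Eventually.of_forall fun v => ?_)
    simp only [smul_eq_mul, RCLike.inner_apply, conj_trivial]
    congr 4
    ring
  have hcf : Integrable fun ξ => charFun μ (2 * Real.pi * ξ) :=
    hμ.comp_mul_left' (by positivity)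
  calc
    ∫ x, g x ∂μ = ∫ x, (1 : ℂ) * (∫ v : ℝ, Complex.exp ((2 * Real.pi * x * v : ℝ) * Complex.I) *
        (𝓕 g) v) ∂μ := by
      refine integral_congr_ae (Eventually.of_forall fun x => ?_)
      simp only [one_mul]
      exact hinv x
    _ = ∫ v, (𝓕 g) v * ∫ x, Complex.exp ((2 * Real.pi * x * v : ℝ) * Complex.I) * 1 ∂μ :=
      integral_cexp_mul_swap (integrable_const _) (SchwartzMap.integrable _) _
    _ = ∫ v, charFun μ (2 * Real.pi * v) * ∫ y : ℝ,
        Complex.exp ((-(2 * Real.pi) * v * y : ℝ) * Complex.I) * g y := by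
      refine integral_congr_ae (Eventually.of_forall fun v => ?_)
      simp only [← hfour]
      rw [mul_comm, charFun_apply_real]
      congr 1
      refine integral_congr_ae (Eventually.of_forall fun x => ?_)
      simp only [mul_one]
      congr 1
      push_cast
      ring
    _ = ∫ y, g y * ∫ v : ℝ, Complex.exp ((-(2 * Real.pi) * v * y : ℝ) * Complex.I) *
        charFun μ (2 * Real.pi * v) :=
      integral_cexp_mul_swap hcf (SchwartzMap.integrable _) _
    _ = _ := by
      refine integral_congr_ae (Eventually.of_forall fun x => ?_)
      simp only [invCharFun_eq]
      congr 1
      refine integral_congr_ae (Eventually.of_forall fun v => ?_)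
      simp only
      congr 4
      ring

/-- Since bumps are real, taking real parts suffices, and `invCharFun μ` never has to be shown real.
-/
theorem integral_bump_eq {μ : Measure ℝ} [IsFiniteMeasure μ] (hμ : Integrable (charFun μ))
    {c : ℝ} (g : ContDiffBump c) : ∫ x, g x ∂μ = ∫ x, g x * charDensity μ x := by
  have hs : HasCompactSupport fun x => ((g x : ℝ) : ℂ) :=
    g.hasCompactSupport.comp_left Complex.ofReal_zero
  have h := integral_schwartz_eq hμ
    (hs.toSchwartzMap (Complex.ofRealCLM.contDiff.comp g.contDiff))
  have hint : Integrable fun x => (g x : ℂ) * invCharFun μ x :=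
    Continuous.integrable_of_hasCompactSupport
      ((Complex.continuous_ofReal.comp g.continuous).mul (continuous_invCharFun hμ)) hs.mul_right
  have h1 : ∫ x, ((g x : ℝ) : ℂ) ∂μ = ∫ x, (g x : ℂ) * invCharFun μ x := h
  have h2 := congrArg Complex.re h1
  rw [integral_complex_ofReal, Complex.ofReal_re] at h2
  rw [h2]
  have := integral_re hint
  simp only [RCLike.re_eq_complex_re] at this
  rw [← this]
  simp [charDensity]

/-- Bumps of outer radius `r` whose inner radii tend to `r` converge to the indicator of the open
ball. Dominated convergence applies on both sides, the density being continuous and so integrable on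
the ball. -/
theorem measureReal_ball_eq {μ : Measure ℝ} [IsFiniteMeasure μ] (hμ : Integrable (charFun μ))
    (c : ℝ) {r : ℝ} (hr : 0 < r) :
    μ.real (Metric.ball c r) = ∫ x in Metric.ball c r, charDensity μ x := by
  -- The shift by 2 keeps the inner radius positive at `n = 0`.
  have hpos : ∀ n : ℕ, 0 < r * (1 - 1 / (n + 2 : ℝ)) := fun n => by
    have : 1 / (n + 2 : ℝ) < 1 := by
      rw [div_lt_one (by positivity)]; linarith [Nat.cast_nonneg (α := ℝ) n]
    have := sub_pos.2 this
    positivity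
  have hlt : ∀ n : ℕ, r * (1 - 1 / (n + 2 : ℝ)) < r := fun n => by
    have : 0 < 1 / (n + 2 : ℝ) := by positivity
    nlinarith
  let g : ℕ → ContDiffBump c := fun n => ⟨_, r, hpos n, hlt n⟩
  have hzero : ∀ n x, x ∉ Metric.ball c r → g n x = 0 := fun n x hx => by
    have : x ∉ Function.support (g n) := by rw [(g n).support_eq]; exact hx
    simpa using this
  have hlim : ∀ x, Tendsto (fun n => g n x) atTop
      (𝓝 ((Metric.ball c r).indicator (fun _ => (1 : ℝ)) x)) := by
    intro x
    by_cases hx : x ∈ Metric.ball c r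
    · rw [Set.indicator_of_mem hx]
      have h1 : Tendsto (fun n : ℕ => r * (1 - 1 / (n + 2 : ℝ))) atTop (𝓝 (r * (1 - 0))) := by
        refine Tendsto.const_mul _ (tendsto_const_nhds.sub ?_)
        simp only [one_div]
        exact tendsto_inv_atTop_zero.comp
          (tendsto_atTop_add_const_right _ _ tendsto_natCast_atTop_atTop)
      rw [sub_zero, mul_one] at h1
      refine tendsto_const_nhds.congr' ?_
      filter_upwards [h1.eventually_const_lt (Metric.mem_ball.1 hx)] with n hn
      exact ((g n).one_of_mem_closedBall (Metric.mem_closedBall.2 hn.le)).symm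
    · rw [Set.indicator_of_notMem hx]
      refine tendsto_const_nhds.congr fun n => (hzero n x hx).symm
  have hcd := continuous_charDensity hμ
  have hI : Integrable ((Metric.ball c r).indicator fun x => |charDensity μ x|) := by
    rw [integrable_indicator_iff Metric.isOpen_ball.measurableSet]
    exact ((hcd.abs.continuousOn (s := Metric.closedBall c r)).integrableOn_compact
      (isCompact_closedBall _ _)).mono_set Metric.ball_subset_closedBall
  have hL : Tendsto (fun n => ∫ x, g n x ∂μ) atTop
      (𝓝 (∫ x, (Metric.ball c r).indicator (fun _ => (1 : ℝ)) x ∂μ)) := by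
    refine tendsto_integral_of_dominated_convergence (fun _ => (1 : ℝ)) (fun n => ?_)
      (integrable_const _) (fun n => ?_) (Eventually.of_forall hlim)
    · exact (g n).continuous.aestronglyMeasurable
    · refine Eventually.of_forall fun x => ?_
      rw [Real.norm_of_nonneg (g n).nonneg]
      exact (g n).le_one
  have hR : Tendsto (fun n => ∫ x, g n x * charDensity μ x) atTop
      (𝓝 (∫ x, (Metric.ball c r).indicator (fun _ => (1 : ℝ)) x * charDensity μ x)) := by
    refine tendsto_integral_of_dominated_convergence _ (fun n => ?_)
      hI (fun n => ?_) (Eventually.of_forall fun x => (hlim x).mul_const _)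
    · exact ((g n).continuous.mul hcd).aestronglyMeasurable
    · refine Eventually.of_forall fun x => ?_
      by_cases hx : x ∈ Metric.ball c r
      · rw [Set.indicator_of_mem hx, norm_mul, Real.norm_of_nonneg (g n).nonneg]
        exact mul_le_of_le_one_left (norm_nonneg _) (g n).le_one
      · rw [hzero n x hx, Set.indicator_of_notMem hx]; simp
  have := tendsto_nhds_unique hL (hR.congr fun n => (integral_bump_eq hμ (g n)).symm)
  rw [← Pi.one_def, integral_indicator_one Metric.isOpen_ball.measurableSet] at this
  rw [this, ← integral_indicator Metric.isOpen_ball.measurableSet]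
  congr 1
  ext x
  by_cases hx : x ∈ Metric.ball c r <;> simp [hx]

/-- A negative value would persist on a small ball by continuity and give that ball negative mass.
-/
theorem charDensity_nonneg {μ : Measure ℝ} [IsFiniteMeasure μ] (hμ : Integrable (charFun μ))
    (x : ℝ) : 0 ≤ charDensity μ x := by
  by_contra! hx
  have hcd := continuous_charDensity hμ
  obtain ⟨r, hr, hball⟩ := Metric.eventually_nhds_iff_ball.1
    (hcd.continuousAt.eventually_lt_const (show charDensity μ x < charDensity μ x / 2 by linarith))
  have h0 : 0 ≤ μ.real (Metric.ball x r) := measureReal_nonneg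
  rw [measureReal_ball_eq hμ x hr] at h0
  have hint : IntegrableOn (charDensity μ) (Metric.ball x r) :=
    ((hcd.continuousOn (s := Metric.closedBall x r)).integrableOn_compact
      (isCompact_closedBall _ _)).mono_set Metric.ball_subset_closedBall
  have h1 : ∫ y in Metric.ball x r, charDensity μ y ≤
      ∫ y in Metric.ball x r, charDensity μ x / 2 := by
    refine setIntegral_mono_on hint (integrableOn_const measure_ball_lt_top.ne (by simp))
      Metric.isOpen_ball.measurableSet
      fun y hy => (hball y hy).le
  rw [setIntegral_const, smul_eq_mul, Measure.real, Real.volume_ball,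
    ENNReal.toReal_ofReal (by positivity)] at h1
  have : 2 * r * (charDensity μ x / 2) < 0 := mul_neg_of_pos_of_neg (by positivity) (by linarith)
  linarith

/-- **Fourier inversion**: a finite measure on `ℝ` with integrable characteristic function has
density `charDensity μ`. -/
theorem eq_withDensity_charDensity {μ : Measure ℝ} [IsFiniteMeasure μ]
    (hμ : Integrable (charFun μ)) :
    μ = volume.withDensity fun x => ENNReal.ofReal (charDensity μ x) := by
  refine Real.measure_ext_Ioo_rat fun a b => ?_
  rcases le_or_gt (b : ℝ) a with hab | hab
  · simp [Set.Ioo_eq_empty_of_le hab]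
  have hcd := continuous_charDensity hμ
  have hr : 0 < ((b : ℝ) - a) / 2 := by linarith
  rw [withDensity_apply _ measurableSet_Ioo, Real.Ioo_eq_ball]
  rw [← ofReal_integral_eq_lintegral_ofReal, ← measureReal_ball_eq hμ _ hr, ofReal_measureReal]
  · exact ((hcd.continuousOn (s := Metric.closedBall _ _)).integrableOn_compact
      (isCompact_closedBall _ _)).mono_set Metric.ball_subset_closedBall
  · exact Eventually.of_forall fun x => charDensity_nonneg hμ x

theorem rnDeriv_toReal_ae {μ : Measure ℝ} [IsFiniteMeasure μ] (hμ : Integrable (charFun μ)) :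
    (fun x => (μ.rnDeriv volume x).toReal) =ᵐ[volume] charDensity μ := by
  have h := Measure.rnDeriv_withDensity (volume : Measure ℝ)
    (f := fun x => ENNReal.ofReal (charDensity μ x))
    (continuous_charDensity hμ).measurable.ennreal_ofReal
  rw [← eq_withDensity_charDensity hμ] at h
  filter_upwards [h] with x hx
  rw [hx, ENNReal.toReal_ofReal (charDensity_nonneg hμ x)]

/-! ### Entropy through the continuous density, and its scaling. -/

theorem diffEntropy_eq {μ : Measure ℝ} [IsFiniteMeasure μ] (hμ : Integrable (charFun μ)) :
    diffEntropy μ = ∫ x, Real.negMulLog (charDensity μ x) := by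
  refine integral_congr_ae ?_
  filter_upwards [rnDeriv_toReal_ae hμ] with x hx
  rw [hx]

theorem hasFiniteDiffEntropy_iff {μ : Measure ℝ} [IsFiniteMeasure μ]
    (hμ : Integrable (charFun μ)) :
    HasFiniteDiffEntropy μ ↔ Integrable fun x => Real.negMulLog (charDensity μ x) := by
  have h : (fun x => Real.negMulLog (μ.rnDeriv volume x).toReal) =ᵐ[volume]
      fun x => Real.negMulLog (charDensity μ x) := by
    filter_upwards [rnDeriv_toReal_ae hμ] with x hx
    rw [hx]
  rw [HasFiniteDiffEntropy, integrable_congr h, and_iff_right]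
  rw [eq_withDensity_charDensity hμ]
  exact withDensity_absolutelyContinuous _ _

theorem integrable_charDensity {μ : Measure ℝ} [IsFiniteMeasure μ]
    (hμ : Integrable (charFun μ)) : Integrable (charDensity μ) := by
  refine ⟨(continuous_charDensity hμ).aestronglyMeasurable, ?_⟩
  rw [hasFiniteIntegral_iff_ofReal (Eventually.of_forall (charDensity_nonneg hμ)),
    ← setLIntegral_univ, ← withDensity_apply _ MeasurableSet.univ, ← eq_withDensity_charDensity hμ]
  exact measure_lt_top _ _

theorem integral_charDensity {μ : Measure ℝ} [IsProbabilityMeasure μ]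
    (hμ : Integrable (charFun μ)) : ∫ x, charDensity μ x = 1 := by
  rw [integral_eq_lintegral_of_nonneg_ae (Eventually.of_forall (charDensity_nonneg hμ))
    (continuous_charDensity hμ).aestronglyMeasurable, ← setLIntegral_univ,
    ← withDensity_apply _ MeasurableSet.univ, ← eq_withDensity_charDensity hμ]
  simp

theorem charDensity_map_mul (μ : Measure ℝ) {c : ℝ} (hc : 0 < c) (x : ℝ) :
    charDensity (μ.map (c * ·)) x = c⁻¹ * charDensity μ (c⁻¹ * x) := by
  have h := Measure.integral_comp_mul_left
    (fun ξ : ℝ => Complex.exp ((-(c⁻¹ * x) * ξ : ℝ) * Complex.I) * charFun μ ξ) c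
  rw [abs_of_pos (by positivity)] at h
  have h' : invCharFun (μ.map (c * ·)) x = (c⁻¹ : ℝ) * invCharFun μ (c⁻¹ * x) := by
    rw [invCharFun, invCharFun, mul_left_comm, ← Complex.real_smul (x := c⁻¹), ← h]
    congr 1
    refine integral_congr_ae (Eventually.of_forall fun ξ => ?_)
    simp only [charFun_map_mul]
    congr 4
    field_simp
  rw [charDensity, h', Complex.re_ofReal_mul, charDensity]

/-- Scaling of the differential entropy. -/
theorem diffEntropy_map_mul {μ : Measure ℝ} [IsProbabilityMeasure μ]
    (hμ : Integrable (charFun μ)) (hfin : HasFiniteDiffEntropy μ) {c : ℝ} (hc : 0 < c) :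
    diffEntropy (μ.map (c * ·)) = diffEntropy μ + Real.log c := by
  have : IsProbabilityMeasure (μ.map (c * ·)) :=
    Measure.isProbabilityMeasure_map (by fun_prop)
  have hcf : Integrable (charFun (μ.map (c * ·))) := by
    have : charFun (μ.map (c * ·)) = fun ξ => charFun μ (c * ξ) := by
      ext ξ; exact charFun_map_mul c ξ
    rw [this]
    exact hμ.comp_mul_left' hc.ne'
  rw [diffEntropy_eq hcf, diffEntropy_eq hμ]
  have h := Measure.integral_comp_mul_left
    (fun y => Real.negMulLog (c⁻¹ * charDensity μ y)) c⁻¹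
  rw [inv_inv, abs_of_pos hc] at h
  simp only [charDensity_map_mul μ hc]
  rw [h, smul_eq_mul, ← integral_const_mul]
  have hcong : ∀ y, c * Real.negMulLog (c⁻¹ * charDensity μ y) =
      Real.negMulLog (charDensity μ y) + charDensity μ y * Real.log c := by
    intro y
    rw [Real.negMulLog_mul, Real.negMulLog, Real.log_inv]
    field_simp
    ring
  simp only [hcong]
  rw [integral_add ((hasFiniteDiffEntropy_iff hμ).1 hfin)
    ((integrable_charDensity hμ).mul_const _), integral_mul_const, integral_charDensity hμ, one_mul]

/-! ### Tails, fractional moments and pointwise bounds on `y log y`. -/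

/-- Tail bound from the behaviour of the characteristic function near the origin. -/
theorem measureReal_abs_gt_le_rpow {μ : Measure ℝ} [IsProbabilityMeasure μ] {C p : ℝ}
    (hp : 0 < p) (h : ∀ ξ, |ξ| ≤ 2 → ‖1 - charFun μ ξ‖ ≤ C * |ξ| ^ p) {r : ℝ} (hr : 1 ≤ r) :
    μ.real {x | r < |x|} ≤ 2 * C * 2 ^ p * r ^ (-p) := by
  have hr0 : 0 < r := by linarith
  have hC : 0 ≤ C := by
    have := (norm_nonneg _).trans (h 1 (by norm_num))
    simpa using this
  -- The tail is bounded by an integral over `[-2/r, 2/r]`, which lies in `[-2, 2]` as `r ≥ 1`.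
  -- Hence the restriction `|ξ| ≤ 2` in the hypothesis.
  have hle : 2 * r⁻¹ ≤ 2 := by
    have := inv_le_one_of_one_le₀ hr; linarith
  have hpos : 0 < 2 * r⁻¹ := by positivity
  refine (measureReal_abs_gt_le_integral_charFun hr0).trans ?_
  have h1 : ‖∫ t in (-2 * r⁻¹)..(2 * r⁻¹), 1 - charFun μ t‖ ≤
      C * (2 * r⁻¹) ^ p * |2 * r⁻¹ - -2 * r⁻¹| := by
    refine intervalIntegral.norm_integral_le_of_norm_le_const fun x hx => ?_
    have hx' : |x| ≤ 2 * r⁻¹ := by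
      rw [Set.uIoc_of_le (by linarith)] at hx
      rw [abs_le]
      constructor <;> linarith [hx.1, hx.2]
    refine (h x (hx'.trans hle)).trans ?_
    gcongr
  have h2 : |2 * r⁻¹ - -2 * r⁻¹| = 4 * r⁻¹ := by
    rw [abs_of_pos (by linarith)]; ring
  rw [h2] at h1
  calc _ ≤ 2⁻¹ * r * (C * (2 * r⁻¹) ^ p * (4 * r⁻¹)) := by gcongr
    _ = _ := by
      rw [Real.mul_rpow (by norm_num) (by positivity), Real.inv_rpow hr0.le, Real.rpow_neg hr0.le]
      field_simp
      ring

/-- Polynomial tails give a moment bound. -/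
theorem lintegral_abs_rpow_le {μ : Measure ℝ} [IsProbabilityMeasure μ] {K p q : ℝ}
    (hK : 0 ≤ K) (hq : 0 < q) (hqp : q < p)
    (h : ∀ r, 1 ≤ r → μ.real {x | r < |x|} ≤ K * r ^ (-p)) :
    ∫⁻ x, ENNReal.ofReal (|x| ^ q) ∂μ ≤ ENNReal.ofReal (1 + q * K / (p - q)) := by
  -- Layer-cake formula: levels below 1 use only that `μ` has mass 1 and contribute `1/q`, levels
  -- above 1 use the tail bound and contribute `K / (p - q)`.
  rw [lintegral_rpow_eq_lintegral_meas_lt_mul μ (Eventually.of_forall fun x => abs_nonneg x)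
    (by fun_prop) hq]
  have hsplit : Set.Ioi (0 : ℝ) = Set.Ioc 0 1 ∪ Set.Ioi 1 :=
    (Set.Ioc_union_Ioi_eq_Ioi zero_le_one).symm
  have h01 : ∫⁻ t in Set.Ioc (0 : ℝ) 1, μ {a | t < |a|} * ENNReal.ofReal (t ^ (q - 1)) ≤
      ENNReal.ofReal q⁻¹ := by
    calc _ ≤ ∫⁻ t in Set.Ioc (0 : ℝ) 1, ENNReal.ofReal (t ^ (q - 1)) :=
          lintegral_mono fun t => mul_le_of_le_one_left' prob_le_one
      _ = ENNReal.ofReal (∫ t in Set.Ioc (0 : ℝ) 1, t ^ (q - 1)) := by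
          rw [ofReal_integral_eq_lintegral_ofReal]
          · exact (intervalIntegrable_iff_integrableOn_Ioc_of_le zero_le_one).1
              (intervalIntegral.intervalIntegrable_rpow' (by linarith))
          · filter_upwards [ae_restrict_mem measurableSet_Ioc] with t ht
            exact Real.rpow_nonneg ht.1.le _
      _ = _ := by
          rw [← intervalIntegral.integral_of_le zero_le_one, integral_rpow (Or.inl (by linarith))]
          congr 1
          rw [sub_add_cancel, Real.one_rpow, Real.zero_rpow hq.ne', sub_zero, one_div]
  have h1 : ∫⁻ t in Set.Ioi (1 : ℝ), μ {a | t < |a|} * ENNReal.ofReal (t ^ (q - 1)) ≤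
      ENNReal.ofReal (K / (p - q)) := by
    calc _ ≤ ∫⁻ t in Set.Ioi (1 : ℝ), ENNReal.ofReal (K * t ^ (q - p - 1)) := by
          refine setLIntegral_mono (by fun_prop) fun t ht => ?_
          have ht0 : 0 < t := zero_lt_one.trans ht
          rw [← ofReal_measureReal, ← ENNReal.ofReal_mul measureReal_nonneg]
          refine ENNReal.ofReal_le_ofReal ?_
          calc _ ≤ K * t ^ (-p) * t ^ (q - 1) :=
                mul_le_mul_of_nonneg_right (h t (le_of_lt ht)) (Real.rpow_nonneg ht0.le _)
            _ = _ := by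
                rw [mul_assoc, ← Real.rpow_add ht0]; congr 2; ring
      _ = ENNReal.ofReal (∫ t in Set.Ioi (1 : ℝ), K * t ^ (q - p - 1)) := by
          rw [ofReal_integral_eq_lintegral_ofReal]
          · exact (integrableOn_Ioi_rpow_of_lt (by linarith) zero_lt_one).const_mul _
          · filter_upwards [ae_restrict_mem measurableSet_Ioi] with t ht
            have ht0 : 0 < t := zero_lt_one.trans ht
            positivity
      _ = _ := by
          rw [integral_const_mul, integral_Ioi_rpow_of_lt (by linarith) zero_lt_one]
          congr 1
          rw [Real.one_rpow]
          have : p - q ≠ 0 := by linarith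
          have : q - p - 1 + 1 ≠ 0 := by linarith
          field_simp
          ring
  rw [hsplit, lintegral_union measurableSet_Ioi (Set.Ioc_disjoint_Ioi le_rfl)]
  calc _ ≤ ENNReal.ofReal q * (ENNReal.ofReal q⁻¹ + ENNReal.ofReal (K / (p - q))) := by gcongr
    _ = _ := by
      have : 0 < p - q := by linarith
      rw [← ENNReal.ofReal_add (by positivity) (by positivity), ← ENNReal.ofReal_mul hq.le]
      congr 1
      field_simp

/-- Split at `y = |x| ^ (-3)`. Above it, `|log y| ≤ log M + 3 log |x|`, and the logarithm costs only
a factor `|x| ^ q`, payable by a moment. Below it, `-y log y ≤ 3 y ^ (2/3) ≤ 3 |x| ^ (-2)`, which is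
integrable at infinity. -/
theorem abs_negMulLog_le {M q x y : ℝ} (hM : 1 ≤ M) (hq : 0 < q) (hx : 1 ≤ |x|) (hy : 0 ≤ y)
    (hyM : y ≤ M) :
    |Real.negMulLog y| ≤ (Real.log M + 3 / q) * (y * |x| ^ q) + 3 * |x| ^ (-2 : ℝ) := by
  have hx0 : 0 < |x| := by linarith
  have hlogM : 0 ≤ Real.log M := Real.log_nonneg hM
  rcases le_or_gt (|x| ^ (-3 : ℝ)) y with h | h
  · have hy0 : 0 < y := lt_of_lt_of_le (by positivity) h
    have h1 : Real.log y ≤ Real.log M := Real.log_le_log hy0 hyM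
    have h2 : -3 * Real.log |x| ≤ Real.log y := by
      rw [← Real.log_rpow hx0]
      exact Real.log_le_log (by positivity) h
    have h3 : Real.log |x| ≤ |x| ^ q / q := Real.log_le_rpow_div hx0.le hq
    have h4 : 1 ≤ |x| ^ q := Real.one_le_rpow hx hq.le
    have h5 : 0 ≤ Real.log |x| := Real.log_nonneg hx
    have h6 : |Real.log y| ≤ (Real.log M + 3 / q) * |x| ^ q := by
      have h7 : |Real.log y| ≤ Real.log M + 3 * Real.log |x| := by
        rw [abs_le]; constructor <;> linarith
      have h8 : Real.log M ≤ Real.log M * |x| ^ q := le_mul_of_one_le_right hlogM h4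
      calc _ ≤ Real.log M * |x| ^ q + 3 * (|x| ^ q / q) := by linarith
        _ = _ := by ring
    have h9 : |Real.negMulLog y| = y * |Real.log y| := by
      rw [Real.negMulLog, abs_mul, abs_neg, abs_of_nonneg hy]
    rw [h9]
    have : 0 ≤ 3 * |x| ^ (-2 : ℝ) := by positivity
    calc _ ≤ y * ((Real.log M + 3 / q) * |x| ^ q) := by gcongr
      _ ≤ _ := by linarith
  · have h0 : 0 ≤ (Real.log M + 3 / q) * (y * |x| ^ q) := by positivity
    rcases hy.eq_or_lt with rfl | hy0
    · simp only [Real.negMulLog_zero, abs_zero]; positivity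
    have hy1 : y ≤ 1 := h.le.trans (Real.rpow_le_one_of_one_le_of_nonpos hx (by norm_num))
    rw [abs_of_nonneg (Real.negMulLog_nonneg hy hy1)]
    have h1 : -Real.log y ≤ 3 * y ^ (-(1 / 3) : ℝ) := by
      have := Real.log_le_rpow_div (x := y⁻¹) (ε := 1 / 3) (by positivity) (by norm_num)
      rw [Real.log_inv, Real.inv_rpow hy, ← Real.rpow_neg hy] at this
      linarith
    have h2 : Real.negMulLog y ≤ 3 * y ^ (2 / 3 : ℝ) := by
      have : y ^ (2 / 3 : ℝ) = y * y ^ (-(1 / 3) : ℝ) := by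
        nth_rewrite 2 [← Real.rpow_one y]
        rw [← Real.rpow_add hy0]; norm_num
      rw [this, Real.negMulLog]
      nlinarith
    have h3 : y ^ (2 / 3 : ℝ) ≤ |x| ^ (-2 : ℝ) := by
      calc _ ≤ (|x| ^ (-3 : ℝ)) ^ (2 / 3 : ℝ) := Real.rpow_le_rpow hy h.le (by norm_num)
        _ = _ := by rw [← Real.rpow_mul hx0.le]; norm_num
    linarith

theorem abs_negMulLog_le_const {M y : ℝ} (hM : 1 ≤ M) (hy : 0 ≤ y) (hyM : y ≤ M) :
    |Real.negMulLog y| ≤ M * Real.log M + 1 := by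
  have hlogM : 0 ≤ Real.log M := Real.log_nonneg hM
  rcases hy.eq_or_lt with rfl | hy0
  · simp only [Real.negMulLog_zero, abs_zero]; positivity
  rw [Real.negMulLog, abs_le]
  have h1 : Real.log y ≤ Real.log M := Real.log_le_log hy0 hyM
  have h2 : 1 - y⁻¹ ≤ Real.log y := Real.one_sub_inv_le_log_of_pos hy0
  have h3 : y * (1 - y⁻¹) ≤ y * Real.log y := by gcongr
  have h4 : y * (1 - y⁻¹) = y - 1 := by field_simp
  have h5 : y * Real.log y ≤ M * Real.log M := by
    calc _ ≤ y * Real.log M := by gcongr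
      _ ≤ _ := by gcongr
  constructor
  · linarith
  · have : 0 ≤ M * Real.log M := by positivity
    linarith

/-! ### Uniform integrability of the entropy integrand and continuity of entropy. -/

/-- Bounds on a characteristic function, uniform over a family of laws, that control the
differential entropies of the family. -/
structure CharFunBound (G : ℝ → ℝ) (C p : ℝ) (μ : Measure ℝ) : Prop where
  norm_le : ∀ ξ, ‖charFun μ ξ‖ ≤ G ξ
  norm_one_sub_le : ∀ ξ, |ξ| ≤ 2 → ‖1 - charFun μ ξ‖ ≤ C * |ξ| ^ p

theorem CharFunBound.integrable {G : ℝ → ℝ} {C p : ℝ} {μ : Measure ℝ} [IsFiniteMeasure μ]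
    (h : CharFunBound G C p μ) (hG : Integrable G) : Integrable (charFun μ) :=
  hG.mono' measurable_charFun.aestronglyMeasurable (Eventually.of_forall h.norm_le)

/-- Uniform tail estimate for the entropy integrand. -/
theorem exists_entropy_tail_bound {G : ℝ → ℝ} (hG : Integrable G) (C : ℝ) {p : ℝ} (hp : 0 < p) :
    ∃ A D q : ℝ, 0 < q ∧ ∀ μ : Measure ℝ, IsProbabilityMeasure μ → CharFunBound G C p μ →
      (∀ x, |Real.negMulLog (charDensity μ x)| ≤ A) ∧
      ∀ R, 1 ≤ R → IntegrableOn (fun x => Real.negMulLog (charDensity μ x))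
          (Metric.closedBall 0 R)ᶜ ∧
        ∫ x in (Metric.closedBall 0 R)ᶜ, |Real.negMulLog (charDensity μ x)| ≤ D * R ^ (-q) := by
  set M : ℝ := max 1 (∫ ξ, G ξ)
  have hM : 1 ≤ M := le_max_left _ _
  -- `2q < p` keeps the moment of order `2q` finite, leaving a spare `|x| ^ q` to be traded for `R ^
  -- (-q)`; `q ≤ 1/2` keeps `|x| ^ (-(2 - q))` integrable at infinity.
  set q : ℝ := min (p / 4) (1 / 2)
  have hq : 0 < q := lt_min (by positivity) (by norm_num)
  have hqp : 2 * q < p := by have := min_le_left (p / 4) (1 / 2); linarith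
  have hq1 : q ≤ 1 / 2 := min_le_right _ _
  -- `E` bounds the moment of order `2q`: it is the constant of `lintegral_abs_rpow_le` fed with
  -- that of `measureReal_abs_gt_le_rpow`.
  set E : ℝ := 1 + 2 * q * (2 * |C| * 2 ^ p) / (p - 2 * q)
  set J : ℝ := ∫ x in (Metric.closedBall (0 : ℝ) 1)ᶜ, |x| ^ (-(2 - q) : ℝ)
  have hlogM : 0 ≤ Real.log M := Real.log_nonneg hM
  have hJint : IntegrableOn (fun x : ℝ => |x| ^ (-(2 - q) : ℝ)) (Metric.closedBall (0 : ℝ) 1)ᶜ := by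
    have h1 : Integrable (fun x : ℝ => (2 : ℝ) ^ (2 - q) * (1 + ‖x‖) ^ (-(2 - q) : ℝ)) :=
      (integrable_one_add_norm (by rw [Module.finrank_self, Nat.cast_one]; linarith)).const_mul _
    refine h1.integrableOn.mono' (Measurable.aestronglyMeasurable (by fun_prop)) ?_
    filter_upwards [ae_restrict_mem Metric.isClosed_closedBall.measurableSet.compl] with x hx
    have hx1 : 1 < |x| := by simpa using hx
    have hx0 : 0 < |x| := zero_lt_one.trans hx1
    rw [Real.norm_of_nonneg (by positivity), Real.norm_eq_abs, Real.rpow_neg hx0.le,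
      Real.rpow_neg (by positivity), ← div_eq_mul_inv,
      ← Real.div_rpow (by norm_num) (by positivity),
      ← Real.inv_rpow hx0.le]
    refine Real.rpow_le_rpow (by positivity) ?_ (by linarith)
    rw [inv_eq_one_div, div_le_div_iff₀ hx0 (by positivity)]
    linarith
  refine ⟨M * Real.log M + 1, (Real.log M + 3 / q) * E + 3 * J, q, hq, fun μ _ hμ => ?_⟩
  have hcf := hμ.integrable hG
  have hnn := charDensity_nonneg hcf
  have hcont := continuous_charDensity hcf
  have hle : ∀ x, charDensity μ x ≤ M := fun x =>
    ((Complex.re_le_norm _).trans (norm_invCharFun_le hG hμ.norm_le x)).trans (le_max_right _ _)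
  refine ⟨fun x => abs_negMulLog_le_const hM (hnn x) (hle x), fun R hR => ?_⟩
  have hR0 : 0 < R := by linarith
  have hpq : 0 < p - 2 * q := by linarith
  have hE0 : 0 ≤ E := by positivity
  have hmom : ∫⁻ x, ENNReal.ofReal (|x| ^ (2 * q)) ∂μ ≤ ENNReal.ofReal E := by
    refine lintegral_abs_rpow_le (by positivity) (by positivity) hqp fun r hr => ?_
    refine measureReal_abs_gt_le_rpow (C := |C|) hp (fun ξ hξ => ?_) hr
    refine (hμ.norm_one_sub_le ξ hξ).trans ?_
    gcongr
    exact le_abs_self C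
  have hmom' : ∫⁻ x, ENNReal.ofReal (charDensity μ x * |x| ^ (2 * q)) ≤ ENNReal.ofReal E := by
    refine le_trans (le_of_eq ?_) hmom
    conv_rhs => rw [eq_withDensity_charDensity hcf]
    rw [lintegral_withDensity_eq_lintegral_mul _ hcont.measurable.ennreal_ofReal (by fun_prop)]
    refine lintegral_congr fun x => ?_
    rw [Pi.mul_apply, ENNReal.ofReal_mul (hnn x)]
  have hmeas : AEStronglyMeasurable (fun x => charDensity μ x * |x| ^ (2 * q)) volume :=
    (hcont.measurable.mul (by fun_prop)).aestronglyMeasurable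
  have hmomint : Integrable fun x => charDensity μ x * |x| ^ (2 * q) := by
    refine ⟨hmeas, ?_⟩
    rw [hasFiniteIntegral_iff_ofReal
      (Eventually.of_forall fun x => mul_nonneg (hnn x) (by positivity))]
    exact hmom'.trans_lt ENNReal.ofReal_lt_top
  have hmomle : ∫ x, charDensity μ x * |x| ^ (2 * q) ≤ E := by
    rw [integral_eq_lintegral_of_nonneg_ae
      (Eventually.of_forall fun x => mul_nonneg (hnn x) (by positivity)) hmeas]
    exact ENNReal.toReal_le_of_le_ofReal hE0 hmom'
  have hsub : (Metric.closedBall (0 : ℝ) R)ᶜ ⊆ (Metric.closedBall (0 : ℝ) 1)ᶜ :=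
    Set.compl_subset_compl.2 (Metric.closedBall_subset_closedBall hR)
  -- The majorant of `abs_negMulLog_le` with both powers of `|x|` raised by `q`, which for `|x| > R`
  -- is compensated by `R ^ (-q)`.
  set g : ℝ → ℝ := fun x => R ^ (-q) * ((Real.log M + 3 / q) * (charDensity μ x * |x| ^ (2 * q)) +
    3 * |x| ^ (-(2 - q) : ℝ))
  have hgint : IntegrableOn g (Metric.closedBall (0 : ℝ) R)ᶜ :=
    ((hmomint.integrableOn.const_mul _).add
      ((hJint.mono_set hsub).const_mul _)).const_mul _
  have hbound : ∀ x ∈ (Metric.closedBall (0 : ℝ) R)ᶜ, |Real.negMulLog (charDensity μ x)| ≤ g x := by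
    intro x hx
    have hxR : R < |x| := by simpa using hx
    have hx0 : 0 < |x| := hR0.trans hxR
    refine (abs_negMulLog_le hM hq (hR.trans hxR.le) (hnn x) (hle x)).trans ?_
    have h1 : |x| ^ q ≤ R ^ (-q) * |x| ^ (2 * q) := by
      have : |x| ^ q = |x| ^ (-q) * |x| ^ (2 * q) := by
        rw [← Real.rpow_add hx0]; congr 1; ring
      rw [this]
      gcongr ?_ * _
      exact Real.rpow_le_rpow_of_nonpos hR0 hxR.le (by linarith)
    have h2 : |x| ^ (-2 : ℝ) ≤ R ^ (-q) * |x| ^ (-(2 - q) : ℝ) := by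
      have : |x| ^ (-2 : ℝ) = |x| ^ (-q) * |x| ^ (-(2 - q) : ℝ) := by
        rw [← Real.rpow_add hx0]; congr 1; ring
      rw [this]
      gcongr ?_ * _
      exact Real.rpow_le_rpow_of_nonpos hR0 hxR.le (by linarith)
    calc _ ≤ (Real.log M + 3 / q) * (charDensity μ x * (R ^ (-q) * |x| ^ (2 * q))) +
          3 * (R ^ (-q) * |x| ^ (-(2 - q) : ℝ)) := by
          have := hnn x
          gcongr
      _ = g x := by simp only [g]; ring
  have hms : MeasurableSet (Metric.closedBall (0 : ℝ) R)ᶜ :=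
    Metric.isClosed_closedBall.measurableSet.compl
  have hint : IntegrableOn (fun x => Real.negMulLog (charDensity μ x))
      (Metric.closedBall 0 R)ᶜ := by
    refine hgint.mono' (Real.continuous_negMulLog.comp hcont).aestronglyMeasurable ?_
    filter_upwards [ae_restrict_mem hms] with x hx
    exact hbound x hx
  refine ⟨hint, (setIntegral_mono_on hint.abs hgint hms hbound).trans ?_⟩
  rw [integral_const_mul, integral_add (hmomint.integrableOn.const_mul _)
    ((hJint.mono_set hsub).const_mul _), integral_const_mul, integral_const_mul, mul_comm]
  gcongr
  · exact (setIntegral_le_integral hmomint (Eventually.of_forall fun x =>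
      mul_nonneg (hnn x) (by positivity))).trans hmomle
  · refine setIntegral_mono_set hJint ?_ (Eventually.of_forall hsub)
    exact Eventually.of_forall fun x => by positivity

theorem CharFunBound.integrable_negMulLog {G : ℝ → ℝ} (hG : Integrable G) {C p : ℝ} (hp : 0 < p)
    {μ : Measure ℝ} [IsProbabilityMeasure μ] (h : CharFunBound G C p μ) :
    Integrable fun x => Real.negMulLog (charDensity μ x) := by
  obtain ⟨A, D, q, -, hAD⟩ := exists_entropy_tail_bound hG C hp
  have h1 := ((hAD μ ‹_› h).2 1 le_rfl).1
  have h2 : IntegrableOn (fun x => Real.negMulLog (charDensity μ x)) (Metric.closedBall 0 1) :=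
    (Real.continuous_negMulLog.comp (continuous_charDensity (h.integrable hG))).continuousOn
      |>.integrableOn_compact (isCompact_closedBall _ _)
  have := h2.union h1
  rwa [Set.union_compl_self, integrableOn_univ] at this

theorem CharFunBound.hasFiniteDiffEntropy {G : ℝ → ℝ} (hG : Integrable G) {C p : ℝ} (hp : 0 < p)
    {μ : Measure ℝ} [IsProbabilityMeasure μ] (h : CharFunBound G C p μ) :
    HasFiniteDiffEntropy μ :=
  (hasFiniteDiffEntropy_iff (h.integrable hG)).2 (h.integrable_negMulLog hG hp)

/-- Continuity of the differential entropy along a convergent family of laws whose characteristic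
functions satisfy uniform bounds. -/
theorem tendsto_diffEntropy {ι : Type*} {l : Filter ι} [l.IsCountablyGenerated] {G : ℝ → ℝ}
    (hG : Integrable G) {C p : ℝ} (hp : 0 < p) {μ : ι → Measure ℝ}
    [∀ i, IsProbabilityMeasure (μ i)] {ν : Measure ℝ} [IsProbabilityMeasure ν]
    (hμ : ∀ᶠ i in l, CharFunBound G C p (μ i)) (hν : CharFunBound G C p ν)
    (hlim : ∀ ξ, Tendsto (fun i => charFun (μ i) ξ) l (𝓝 (charFun ν ξ))) :
    Tendsto (fun i => diffEntropy (μ i)) l (𝓝 (diffEntropy ν)) := by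
  obtain ⟨A, D, q, hq, hAD⟩ := exists_entropy_tail_bound hG C hp
  have hsplit : ∀ R : ℝ, 1 ≤ R → ∀ μ : Measure ℝ, IsProbabilityMeasure μ → CharFunBound G C p μ →
      |diffEntropy μ - ∫ x in Metric.closedBall 0 R, Real.negMulLog (charDensity μ x)| ≤
        D * R ^ (-q) := by
    intro R hR μ _ h
    rw [diffEntropy_eq (h.integrable hG), ← integral_add_compl
      (Metric.isClosed_closedBall (x := (0 : ℝ)) (ε := R)).measurableSet
      (h.integrable_negMulLog hG hp), add_sub_cancel_left]
    exact abs_integral_le_integral_abs.trans ((hAD μ ‹_› h).2 R hR).2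
  rw [Metric.tendsto_nhds]
  intro ε hε
  -- One `R` makes every tail, including that of the limit, less than `ε/3`. On the ball, the
  -- constant `A` dominates.
  have hR : ∃ R : ℝ, 1 ≤ R ∧ D * R ^ (-q) < ε / 3 := by
    have h1 : Tendsto (fun R : ℝ => D * R ^ (-q)) atTop (𝓝 (D * 0)) :=
      (tendsto_rpow_neg_atTop hq).const_mul D
    rw [mul_zero] at h1
    exact ((eventually_ge_atTop 1).and (h1.eventually_lt_const (by positivity))).exists
  obtain ⟨R, hR1, hR⟩ := hR
  have hmain : Tendsto
      (fun i => ∫ x in Metric.closedBall 0 R, Real.negMulLog (charDensity (μ i) x)) l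
      (𝓝 (∫ x in Metric.closedBall 0 R, Real.negMulLog (charDensity ν x))) := by
    refine tendsto_integral_filter_of_dominated_convergence (fun _ => A) ?_ ?_
      (integrableOn_const (measure_closedBall_lt_top (x := (0 : ℝ))).ne (by simp)) ?_
    · filter_upwards [hμ] with i hi
      exact (Real.continuous_negMulLog.comp
        (continuous_charDensity (hi.integrable hG))).aestronglyMeasurable
    · filter_upwards [hμ] with i hi
      exact Eventually.of_forall fun x => (hAD _ inferInstance hi).1 x
    · refine Eventually.of_forall fun x => (Real.continuous_negMulLog.tendsto _).comp ?_
      exact tendsto_charDensity hG (hμ.mono fun i hi => hi.norm_le) hlim x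
  filter_upwards [hμ, Metric.tendsto_nhds.1 hmain (ε / 3) (by positivity)] with i hi hi'
  rw [Real.dist_eq] at hi' ⊢
  have h1 := abs_le.1 (hsplit R hR1 _ inferInstance hi)
  have h2 := abs_le.1 (hsplit R hR1 _ inferInstance hν)
  rw [abs_lt] at hi' ⊢
  constructor <;> linarith [h1.1, h1.2, h2.1, h2.2, hi'.1, hi'.2]

/-! ### Characteristic functions of a Lévy process. -/

variable {Ω : Type*} [MeasurableSpace Ω] {P : Measure Ω} {L : ℝ≥0 → Ω → ℝ}

theorem IsLevyProcess.charFun_add [IsProbabilityMeasure P] (hL : IsLevyProcess L P) (s t : ℝ≥0)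
    (ξ : ℝ) :
    charFun (P.map (L (s + t))) ξ = charFun (P.map (L s)) ξ * charFun (P.map (L t)) ξ := by
  have hind : IndepFun (L s) (L (s + t) - L s) P :=
    hL.indep.indepFun_eval_sub zero_le le_self_add hL.zero
  have h := hind.charFun_map_add_eq_mul (hL.measurable s).aemeasurable
    ((hL.measurable _).sub (hL.measurable s)).aemeasurable
  rw [add_sub_cancel] at h
  rw [h, Pi.mul_apply]
  congr 2
  exact (hL.stationary t s).map_eq.symm

theorem IsLevyProcess.charFun_zero_time [IsProbabilityMeasure P] (hL : IsLevyProcess L P) (ξ : ℝ) :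
    charFun (P.map (L 0)) ξ = 1 := by
  have : P.map (L 0) = Measure.dirac 0 := by
    rw [Measure.map_congr hL.zero]
    exact (Measure.map_const P (0 : ℝ)).trans (by simp)
  rw [this, charFun_dirac]
  simp

theorem IsLevyProcess.charFun_nsmul [IsProbabilityMeasure P] (hL : IsLevyProcess L P) (n : ℕ)
    (t : ℝ≥0) (ξ : ℝ) : charFun (P.map (L (n * t))) ξ = charFun (P.map (L t)) ξ ^ n := by
  induction n with
  | zero => simpa using hL.charFun_zero_time ξ
  | succ n ih =>
    rw [Nat.cast_succ, add_mul, one_mul, hL.charFun_add, ih, pow_succ]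

theorem IsLevyProcess.tendsto_charFun [IsProbabilityMeasure P] (hL : IsLevyProcess L P)
    {u : ℕ → ℝ≥0} {t : ℝ≥0} (hu : Tendsto u atTop (𝓝[≥] t)) (ξ : ℝ) :
    Tendsto (fun n => charFun (P.map (L (u n))) ξ) atTop (𝓝 (charFun (P.map (L t)) ξ)) := by
  have hmap : ∀ s, charFun (P.map (L s)) ξ = ∫ ω, Complex.exp (ξ * L s ω * Complex.I) ∂P := by
    intro s
    rw [charFun_apply_real, integral_map (hL.measurable s).aemeasurable
      (Continuous.aestronglyMeasurable (by fun_prop))]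
  simp only [hmap]
  refine tendsto_integral_of_dominated_convergence (fun _ => (1 : ℝ)) (fun n => ?_)
    (integrable_const _) (fun n => Eventually.of_forall fun ω => ?_) ?_
  · have := hL.measurable (u n)
    exact Measurable.aestronglyMeasurable (by fun_prop)
  · rw [← Complex.ofReal_mul, Complex.norm_exp_ofReal_mul_I]
  · filter_upwards [hL.cadlag] with ω hω
    have h1 : Tendsto (fun n => L (u n) ω) atTop (𝓝 (L t ω)) := (hω t).1.tendsto.comp hu
    have h2 : Continuous fun x : ℝ => Complex.exp (ξ * x * Complex.I) := by fun_prop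
    exact (h2.tendsto _).comp h1

/-- The quotient `ζ` of the two sides is continuous with `ζ ^ n = 1`. It takes finitely many values
on a connected space, so it is constant, equal to `ζ 0 = 1`. This selects the correct `n`-th root.
-/
theorem IsLevyProcess.charFun_inv_nat [IsProbabilityMeasure P] (hL : IsLevyProcess L P)
    {Ψ : ℝ → ℂ} (hΨ : IsCharExponent (P.map (L 1)) Ψ) {n : ℕ} (hn : n ≠ 0) (ξ : ℝ) :
    charFun (P.map (L (n : ℝ≥0)⁻¹)) ξ = Complex.exp ((n : ℂ)⁻¹ * Ψ ξ) := by
  have hprob : ∀ t, IsProbabilityMeasure (P.map (L t)) := fun t =>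
    Measure.isProbabilityMeasure_map (hL.measurable t).aemeasurable
  have hn0 : (n : ℂ) ≠ 0 := Nat.cast_ne_zero.2 hn
  set ζ : ℝ → ℂ := fun ξ =>
    charFun (P.map (L (n : ℝ≥0)⁻¹)) ξ * Complex.exp (-((n : ℂ)⁻¹ * Ψ ξ))
  have hcont : Continuous ζ := continuous_charFun.mul
    (Complex.continuous_exp.comp (continuous_const.mul hΨ.continuous).neg)
  have hpow : ∀ ξ, ζ ξ ^ n = 1 := by
    intro ξ
    simp only [ζ, mul_pow]
    rw [← hL.charFun_nsmul, mul_inv_cancel₀ (Nat.cast_ne_zero.2 hn), ← hΨ.exp_eq,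
      ← Complex.exp_nat_mul, ← Complex.exp_add]
    have : Ψ ξ + n * -((n : ℂ)⁻¹ * Ψ ξ) = 0 := by field_simp; ring
    rw [this, Complex.exp_zero]
  have hfin : {z : ℂ | z ^ n = 1}.Finite := by
    have hX : (Polynomial.X ^ n - 1 : Polynomial ℂ) ≠ 0 :=
      Polynomial.X_pow_sub_C_ne_zero (Nat.pos_of_ne_zero hn) 1
    refine (Polynomial.finite_setOfPred_isRoot hX).subset fun z hz => ?_
    have hz' : z ^ n = 1 := hz
    simp [Polynomial.IsRoot, hz']
  have h0 : ζ 0 = 1 := by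
    have := hprob (n : ℝ≥0)⁻¹
    simp [ζ, hΨ.zero]
  have hconst : ζ ξ = ζ 0 :=
    isPreconnected_univ.constant_of_mapsTo hfin.isDiscrete hcont.continuousOn
      (fun x _ => hpow x) (Set.mem_univ _) (Set.mem_univ _)
  rw [h0] at hconst
  simp only [ζ, Complex.exp_neg] at hconst
  exact (mul_inv_eq_one₀ (Complex.exp_ne_zero _)).1 hconst

/-- The characteristic function of a Lévy process at time `t` is `exp (t Ψ)`. -/
theorem IsLevyProcess.charFun_eq [IsProbabilityMeasure P] (hL : IsLevyProcess L P)
    {Ψ : ℝ → ℂ} (hΨ : IsCharExponent (P.map (L 1)) Ψ) (t : ℝ≥0) (ξ : ℝ) :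
    charFun (P.map (L t)) ξ = Complex.exp (((t : ℝ) : ℂ) * Ψ ξ) := by
  have hrat : ∀ m n : ℕ, n ≠ 0 → charFun (P.map (L (m * (n : ℝ≥0)⁻¹))) ξ =
      Complex.exp (((((m : ℝ≥0) * (n : ℝ≥0)⁻¹ : ℝ≥0) : ℝ) : ℂ) * Ψ ξ) := by
    intro m n hn
    rw [hL.charFun_nsmul, hL.charFun_inv_nat hΨ hn, ← Complex.exp_nat_mul]
    push_cast
    rw [mul_assoc]
  -- Rational times are taken above `t` because the paths are only right-continuous.
  set u : ℕ → ℝ≥0 := fun n => (⌈((n + 1 : ℕ) : ℝ≥0) * t⌉₊ : ℝ≥0) * ((n + 1 : ℕ) : ℝ≥0)⁻¹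
  have hpos : ∀ n : ℕ, (0 : ℝ≥0) < ((n + 1 : ℕ) : ℝ≥0) := fun n => by positivity
  have hge : ∀ n, t ≤ u n := fun n => by
    simp only [u]
    rw [← div_eq_mul_inv, le_div_iff₀ (hpos n), mul_comm]
    exact Nat.le_ceil _
  have hle : ∀ n, u n ≤ t + ((n + 1 : ℕ) : ℝ≥0)⁻¹ := fun n => by
    simp only [u]
    rw [← div_eq_mul_inv, div_le_iff₀ (hpos n), add_mul, inv_mul_cancel₀ (hpos n).ne', mul_comm t]
    exact (Nat.ceil_lt_add_one zero_le).le
  have hu : Tendsto u atTop (𝓝 t) := by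
    refine tendsto_of_tendsto_of_tendsto_of_le_of_le tendsto_const_nhds ?_ hge hle
    have h1 : Tendsto (fun n : ℕ => ((n + 1 : ℕ) : ℝ≥0)⁻¹) atTop (𝓝 0) :=
      (tendsto_add_atTop_iff_nat (f := fun n : ℕ => ((n : ℝ≥0))⁻¹) 1).2
        (tendsto_inv_atTop_zero.comp tendsto_natCast_atTop_atTop)
    simpa using tendsto_const_nhds.add h1
  have hu' : Tendsto u atTop (𝓝[≥] t) :=
    tendsto_nhdsWithin_iff.2 ⟨hu, Eventually.of_forall hge⟩
  refine tendsto_nhds_unique (hL.tendsto_charFun hu' ξ) ?_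
  have hc : Continuous fun s : ℝ≥0 => Complex.exp (((s : ℝ) : ℂ) * Ψ ξ) := by fun_prop
  refine ((hc.tendsto t).comp hu).congr fun n => ?_
  exact (hrat _ _ (Nat.succ_ne_zero n)).symm

/-! ### Asymptotics of a self-similar exponent and the Blumenthal–Getoor index. -/

/-- If `exp (i t g) → 1` for every `t`, then `g → 0`. -/
theorem tendsto_zero_of_tendsto_cexp {ι : Type*} {l : Filter ι} [l.IsCountablyGenerated]
    {g : ι → ℝ}
    (h : ∀ t : ℝ, 0 ≤ t → Tendsto (fun i => Complex.exp ((t * g i : ℝ) * Complex.I)) l (𝓝 1)) :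
    Tendsto g l (𝓝 0) := by
  have hI : Tendsto (fun i => ∫ t in (0 : ℝ)..1, Complex.exp ((t * g i : ℝ) * Complex.I)) l
      (𝓝 (∫ _t in (0 : ℝ)..1, (1 : ℂ))) := by
    refine intervalIntegral.tendsto_integral_filter_of_dominated_convergence (fun _ => 1)
      (Eventually.of_forall fun i => Continuous.aestronglyMeasurable (by fun_prop))
      (Eventually.of_forall fun i => Eventually.of_forall fun t _ => ?_)
      intervalIntegrable_const (Eventually.of_forall fun t ht => ?_)
    · rw [Complex.norm_exp_ofReal_mul_I]
    · rw [Set.uIoc_of_le zero_le_one] at ht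
      exact h t ht.1.le
  -- A single `t` determines `g` only modulo a period. Averaging over `t ∈ [0, 1]` gives `(exp (i g)
  -- - 1) / (i g)`, of modulus at most `2 / |g|`; as it tends to 1, `g` is eventually bounded.
  have hbd : ∀ᶠ i in l, |g i| < 4 := by
    have hn := hI.norm
    simp only [intervalIntegral.integral_const, sub_zero, one_smul, norm_one] at hn
    filter_upwards [hn.eventually_const_lt (show (1 / 2 : ℝ) < 1 by norm_num)] with i hi
    by_contra! hg
    have hg0 : g i ≠ 0 := by
      intro h0; rw [h0, abs_zero] at hg; linarith
    have hc : (g i : ℂ) * Complex.I ≠ 0 :=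
      mul_ne_zero (Complex.ofReal_ne_zero.2 hg0) Complex.I_ne_zero
    have heq : ∫ t in (0 : ℝ)..1, Complex.exp ((t * g i : ℝ) * Complex.I) =
        (Complex.exp ((g i : ℝ) * Complex.I) - 1) / ((g i : ℂ) * Complex.I) := by
      have := integral_exp_mul_complex (a := 0) (b := 1) hc
      simp only [Complex.ofReal_zero, mul_zero, Complex.exp_zero, Complex.ofReal_one, mul_one]
        at this
      rw [← this]
      refine intervalIntegral.integral_congr fun t _ => ?_
      congr 1
      push_cast
      ring
    rw [heq, norm_div, norm_mul, Complex.norm_I, mul_one, Complex.norm_real, Real.norm_eq_abs,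
      lt_div_iff₀ (by linarith)] at hi
    have h2 : ‖Complex.exp ((g i : ℝ) * Complex.I) - 1‖ ≤ 2 := by
      refine (norm_sub_le _ _).trans ?_
      rw [Complex.norm_exp_ofReal_mul_I, norm_one]; norm_num
    linarith
  -- Once `|g| < 4`, the angle `g / 4` lies in `(-π, π]`, so `arg` recovers it exactly.
  have harg : Tendsto (fun i => Complex.arg (Complex.exp ((1 / 4 * g i : ℝ) * Complex.I))) l
      (𝓝 0) := by
    have := (Complex.continuousAt_arg Complex.one_mem_slitPlane).tendsto.comp
      (h (1 / 4) (by norm_num))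
    rwa [Complex.arg_one] at this
  have h4 := harg.const_mul 4
  rw [mul_zero] at h4
  refine h4.congr' ?_
  filter_upwards [hbd] with i hi
  rw [abs_lt] at hi
  have hpi := Real.pi_gt_three
  rw [Complex.arg_exp_mul_I, (toIocMod_eq_self Real.two_pi_pos).2 ⟨by linarith, by linarith⟩]
  ring

/-- The exponent of a characteristic function that is asymptotically self-similar with a real
limit is equivalent to `-γ |ξ| ^ (1 / H)` at infinity. -/
theorem exists_tendsto_div_rpow {Ψ : ℝ → ℂ} (hΨ : Continuous Ψ) (hΨ0 : Ψ 0 = 0)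
    (hsymm : ∀ ξ, Ψ (-ξ) = (starRingEnd ℂ) (Ψ ξ)) {H : ℝ} {χ : ℝ≥0 → ℝ → ℂ}
    (hχ : ∀ t, Continuous (χ t)) (hχ1 : ∀ t ξ, ‖χ t ξ‖ ≤ 1) (hreal : ∀ t ξ, (χ t ξ).im = 0)
    (hlim : ∀ t : ℝ≥0, ∀ ξ : ℝ, Tendsto
      (fun a : ℝ => Complex.exp (((t : ℝ) / a : ℝ) * Ψ (a ^ H * ξ))) atTop (𝓝 (χ t ξ)))
    (hne : ∃ t ξ, χ t ξ ≠ 1) :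
    ∃ γ : ℝ, 0 < γ ∧ 0 < H ∧
      Tendsto (fun ξ : ℝ => Ψ ξ / ((|ξ| ^ (1 / H) : ℝ) : ℂ)) (cocompact ℝ) (𝓝 (-γ : ℂ)) ∧
      ∀ ξ, χ 1 ξ = Complex.exp ((-γ * |ξ| ^ (1 / H) : ℝ) : ℂ) := by
  have hdiv : ∀ t : ℝ, Tendsto (fun a : ℝ => t / a) atTop (𝓝 0) := fun t =>
    tendsto_const_nhds.div_atTop tendsto_id
  have hχ0 : ∀ t, χ t 0 = 1 := fun t => by
    refine tendsto_nhds_unique (hlim t 0) ?_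
    simp [hΨ0]
  -- For `H ≤ 0` the points `a ^ H ξ` stay bounded, so `(t / a) Ψ → 0` and every `χ t` would be 1.
  have hH : 0 < H := by
    by_contra! hH
    obtain ⟨t, ξ, htξ⟩ := hne
    refine htξ (tendsto_nhds_unique (hlim t ξ) ?_)
    obtain ⟨B, hB⟩ := (isCompact_closedBall (0 : ℝ) |ξ|).exists_bound_of_continuousOn
      hΨ.continuousOn
    have h0 : Tendsto (fun a : ℝ => (((t : ℝ) / a : ℝ) : ℂ) * Ψ (a ^ H * ξ)) atTop (𝓝 0) := by
      rw [tendsto_zero_iff_norm_tendsto_zero]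
      refine squeeze_zero' (Eventually.of_forall fun _ => norm_nonneg _) ?_
        (by simpa using (hdiv t).abs.mul_const B)
      filter_upwards [eventually_ge_atTop 1] with a ha
      rw [norm_mul, Complex.norm_real, Real.norm_eq_abs]
      refine mul_le_mul_of_nonneg_left (hB _ ?_) (abs_nonneg _)
      rw [mem_closedBall_zero_iff, norm_mul, Real.norm_eq_abs, Real.norm_eq_abs,
        abs_of_nonneg (by positivity)]
      exact mul_le_of_le_one_left (abs_nonneg _) (Real.rpow_le_one_of_one_le_of_nonpos ha hH)
    simpa [Function.comp_def] using (Complex.continuous_exp.tendsto 0).comp h0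
  set m : ℝ → ℝ := fun ξ => ‖χ 1 ξ‖
  have hm0 : m 0 = 1 := by simp [m, hχ0]
  have hmcont : Continuous m := (hχ 1).norm
  have hmod : ∀ ξ, Tendsto (fun a : ℝ => Real.exp (a⁻¹ * (Ψ (a ^ H * ξ)).re)) atTop (𝓝 (m ξ)) := by
    intro ξ
    refine (hlim 1 ξ).norm.congr fun a => ?_
    rw [Complex.norm_exp, Complex.re_ofReal_mul]
    simp
  have hmodt : ∀ t : ℝ, 0 < t → ∀ ξ,
      Tendsto (fun a : ℝ => Real.exp (t * (a⁻¹ * (Ψ (a ^ H * ξ)).re))) atTop (𝓝 (m ξ ^ t)) := by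
    intro t ht ξ
    refine ((Real.continuous_rpow_const ht.le).tendsto _ |>.comp (hmod ξ)).congr fun a => ?_
    simp only [Function.comp_apply]
    rw [← Real.exp_mul, mul_comm]
  -- Replace `a` by `a c` in the limit defining `m`.
  have hscale : ∀ c : ℝ, 0 < c → ∀ ξ, m (c ^ H * ξ) = m ξ ^ c := by
    intro c hc ξ
    have h1 := (hmodt c hc ξ).comp (tendsto_id.atTop_mul_const hc)
    refine tendsto_nhds_unique (hmod (c ^ H * ξ)) (h1.congr' ?_)
    filter_upwards [eventually_gt_atTop 0] with a ha
    simp only [Function.comp_apply, id]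
    rw [Real.mul_rpow ha.le hc.le, mul_assoc (a ^ H)]
    congr 1
    field_simp
  -- By `hscale` a zero at `ξ` would give zeros at all `c ^ H ξ`, which accumulate at `0`, where `m
  -- = 1`.
  have hmpos : ∀ ξ, 0 < m ξ := by
    intro ξ
    refine (norm_nonneg _).lt_of_ne fun h0 => ?_
    have h1 : Tendsto (fun c : ℝ => m (c ^ H * ξ)) (𝓝[>] 0) (𝓝 1) := by
      have hc : Tendsto (fun c : ℝ => c ^ H * ξ) (𝓝[>] 0) (𝓝 0) := by
        have : Continuous fun c : ℝ => c ^ H * ξ :=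
          (Real.continuous_rpow_const hH.le).mul continuous_const
        have h2 := (this.tendsto 0).mono_left (nhdsWithin_le_nhds (s := Set.Ioi 0))
        simpa [Real.zero_rpow hH.ne'] using h2
      have h3 := (hmcont.tendsto 0).comp hc
      rwa [hm0] at h3
    have h2 : Tendsto (fun c : ℝ => m (c ^ H * ξ)) (𝓝[>] 0) (𝓝 0) := by
      refine tendsto_const_nhds.congr' ?_
      filter_upwards [self_mem_nhdsWithin] with c hc
      have hc' : 0 < c := hc
      rw [hscale c hc', show m ξ = 0 from h0.symm, Real.zero_rpow hc'.ne']
    exact one_ne_zero (tendsto_nhds_unique h1 h2)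
  -- `χ t` is the square of the real number `χ (t / 2)`, hence nonnegative and equal to its modulus.
  have hχm : ∀ t : ℝ≥0, ∀ ξ, χ t ξ = ((m ξ ^ (t : ℝ) : ℝ) : ℂ) := by
    intro t ξ
    rcases eq_or_lt_of_le (zero_le (a := t)) with rfl | ht
    · refine tendsto_nhds_unique (hlim 0 ξ) ?_
      simp
    have hnorm : ‖χ t ξ‖ = m ξ ^ (t : ℝ) := by
      refine tendsto_nhds_unique (hlim t ξ).norm ((hmodt t ht ξ).congr fun a => ?_)
      rw [Complex.norm_exp, Complex.re_ofReal_mul]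
      congr 1
      ring
    have hsq : χ t ξ = χ (t / 2) ξ * χ (t / 2) ξ := by
      refine tendsto_nhds_unique (hlim t ξ) (((hlim (t / 2) ξ).mul (hlim (t / 2) ξ)).congr
        fun a => ?_)
      rw [← Complex.exp_add]
      congr 1
      push_cast
      ring
    have hre : χ t ξ = ((χ t ξ).re : ℂ) := Complex.ext rfl (by simp [hreal])
    have hnn : 0 ≤ (χ t ξ).re := by
      rw [hsq, Complex.mul_re, hreal, mul_zero, sub_zero]
      exact mul_self_nonneg _
    rw [hre, ← hnorm]
    congr 1
    conv_rhs => rw [hre]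
    rw [Complex.norm_real, Real.norm_of_nonneg hnn]
  have heven : ∀ ξ, m (-ξ) = m ξ := by
    intro ξ
    refine tendsto_nhds_unique (hmod (-ξ)) ((hmod ξ).congr fun a => ?_)
    rw [mul_neg, hsymm, Complex.conj_re]
  have hmabs : ∀ ξ, m ξ = m 1 ^ (|ξ| ^ (1 / H)) := by
    intro ξ
    rcases eq_or_ne ξ 0 with rfl | hξ
    · rw [hm0, abs_zero, Real.zero_rpow (by positivity), Real.rpow_zero]
    have hξ' : 0 < |ξ| := abs_pos.2 hξ
    rw [← hscale _ (by positivity), ← Real.rpow_mul hξ'.le, one_div_mul_cancel hH.ne',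
      Real.rpow_one, mul_one]
    rcases abs_choice ξ with h | h
    · rw [h]
    · rw [h, heven]
  set γ : ℝ := -Real.log (m 1)
  have hmexp : m 1 = Real.exp (-γ) := by rw [neg_neg, Real.exp_log (hmpos 1)]
  have hγ0 : 0 ≤ γ := neg_nonneg.2 (Real.log_nonpos (hmpos 1).le (hχ1 1 1))
  have hγ : 0 < γ := by
    refine hγ0.lt_of_ne fun h0 => ?_
    obtain ⟨t, ξ, htξ⟩ := hne
    apply htξ
    rw [hχm, hmabs, hmexp, ← h0]
    simp
  refine ⟨γ, hγ, hH, ?_, fun ξ => ?_⟩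
  · have hre : Tendsto (fun a : ℝ => a⁻¹ * (Ψ (a ^ H * 1)).re) atTop (𝓝 (-γ)) := by
      have h1 := (hmod 1).log (hmpos 1).ne'
      simp only [Real.log_exp] at h1
      rwa [neg_neg]
    -- Dividing the limit by that of its modulus leaves `exp (i t Im)`, which tends to 1 for every
    -- `t ≥ 0`.
    have him : Tendsto (fun a : ℝ => a⁻¹ * (Ψ (a ^ H * 1)).im) atTop (𝓝 0) := by
      refine tendsto_zero_of_tendsto_cexp fun t ht => ?_
      have hn : (((m 1 ^ t : ℝ)) : ℂ) ≠ 0 :=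
        Complex.ofReal_ne_zero.2 (Real.rpow_pos_of_pos (hmpos 1) t).ne'
      have hl := hlim t.toNNReal 1
      rw [hχm, Real.coe_toNNReal t ht] at hl
      have hmt : Tendsto (fun a : ℝ => Real.exp (t * (a⁻¹ * (Ψ (a ^ H * 1)).re))) atTop
          (𝓝 (m 1 ^ t)) := by
        rcases ht.eq_or_lt with rfl | ht
        · simp
        · exact hmodt t ht 1
      have h2 := hl.div ((Complex.continuous_ofReal.tendsto _).comp hmt) hn
      rw [div_self hn] at h2
      refine h2.congr fun a => ?_
      simp only [Function.comp_apply, Pi.div_apply]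
      rw [Complex.ofReal_exp, ← Complex.exp_sub]
      congr 1
      apply Complex.ext <;> simp <;> ring
    have hΨlim : Tendsto (fun a : ℝ => ((a⁻¹ : ℝ) : ℂ) * Ψ (a ^ H * 1)) atTop (𝓝 (-γ : ℂ)) := by
      have h1 := ((Complex.continuous_ofReal.tendsto _).comp hre).add
        (((Complex.continuous_ofReal.tendsto _).comp him).mul_const Complex.I)
      simp only [Complex.ofReal_zero, zero_mul, add_zero, Complex.ofReal_neg] at h1
      refine h1.congr fun a => ?_
      apply Complex.ext <;> simp
    -- Substitute `a = |ξ| ^ (1 / H)`; negative `ξ` follow by conjugation since the limit is real.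
    have hto : Tendsto (fun ξ : ℝ => |ξ| ^ (1 / H)) (cocompact ℝ) atTop :=
      (tendsto_rpow_atTop (by positivity)).comp tendsto_norm_cocompact_atTop
    rw [tendsto_iff_norm_sub_tendsto_zero] at hΨlim ⊢
    refine (hΨlim.comp hto).congr fun ξ => ?_
    simp only [Function.comp_apply]
    rw [← Real.rpow_mul (abs_nonneg _), one_div_mul_cancel hH.ne', Real.rpow_one, mul_one,
      Complex.ofReal_inv, ← div_eq_inv_mul]
    rcases abs_choice ξ with h | h
    · rw [h]
    · rw [h, hsymm, ← h]
      rw [← Complex.norm_conj]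
      congr 1
      simp
  · rw [hχm, hmabs, hmexp, NNReal.coe_one, Real.rpow_one, ← Real.exp_mul, Complex.ofReal_exp]

/-- The admissible exponents form exactly `(α, ∞)`: at `α` the ratio tends to `γ ≠ 0`. -/
theorem sInf_growth_eq {Ψ : ℝ → ℂ} {α γ : ℝ} (hα : 0 < α) (hγ : 0 < γ)
    (h : Tendsto (fun ξ : ℝ => Ψ ξ / ((|ξ| ^ α : ℝ) : ℂ)) (cocompact ℝ) (𝓝 (-γ : ℂ))) :
    sInf {p : ℝ | 0 < p ∧ Tendsto (fun ξ : ℝ => ‖Ψ ξ‖ / |ξ| ^ p) (cocompact ℝ) (𝓝 0)} = α := by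
  have hn : Tendsto (fun ξ : ℝ => ‖Ψ ξ‖ / |ξ| ^ α) (cocompact ℝ) (𝓝 γ) := by
    have h1 := h.norm
    rw [norm_neg, Complex.norm_real, Real.norm_of_nonneg hγ.le] at h1
    refine h1.congr fun ξ => ?_
    rw [norm_div, Complex.norm_real, Real.norm_of_nonneg (by positivity)]
  have habs : Tendsto (fun ξ : ℝ => |ξ|) (cocompact ℝ) atTop := tendsto_norm_cocompact_atTop
  suffices {p : ℝ | 0 < p ∧ Tendsto (fun ξ : ℝ => ‖Ψ ξ‖ / |ξ| ^ p) (cocompact ℝ) (𝓝 0)} =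
      Set.Ioi α by rw [this, csInf_Ioi]
  ext p
  refine ⟨fun ⟨_, hp⟩ => ?_, fun hp => ?_⟩
  · by_contra hpα
    have hpα : p ≤ α := not_lt.1 hpα
    refine hγ.ne' (tendsto_nhds_unique hn (squeeze_zero' (Eventually.of_forall fun ξ => ?_) ?_ hp))
    · positivity
    · filter_upwards [habs.eventually_ge_atTop 1] with ξ hξ
      have : 0 < |ξ| := by linarith
      gcongr
  · have hp' : α < p := hp
    refine ⟨hα.trans hp', ?_⟩
    have h1 : Tendsto (fun ξ : ℝ => |ξ| ^ (-(p - α))) (cocompact ℝ) (𝓝 0) :=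
      (tendsto_rpow_neg_atTop (sub_pos.2 hp')).comp habs
    have h2 := hn.mul h1
    rw [mul_zero] at h2
    refine h2.congr' ?_
    filter_upwards [habs.eventually_gt_atTop 0] with ξ hξ
    rw [neg_sub, Real.rpow_sub hξ]
    field_simp

/-! ### The stable limit of a locally symmetric and self-similar Lévy process. -/

theorem tendsto_charFun_of_tendstoInDistribution {ι Ω' : Type*} [MeasurableSpace Ω']
    [IsProbabilityMeasure P] {P' : Measure Ω'} [IsProbabilityMeasure P'] {X : ι → Ω → ℝ}
    {l : Filter ι} {Y : Ω' → ℝ} (h : TendstoInDistribution X l Y (fun _ => P) P') (ξ : ℝ) :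
    Tendsto (fun i => charFun (P.map (X i)) ξ) l (𝓝 (charFun (P'.map Y) ξ)) := by
  simp_rw [charFun_eq_integral_innerProbChar]
  exact (ProbabilityMeasure.tendsto_iff_forall_integral_rclike_tendsto ℂ).1 h.tendsto
    (BoundedContinuousFunction.innerProbChar ξ)

theorem TendstoInLaw.eval {ι Ω' : Type*} [MeasurableSpace Ω'] {X : ι → ℝ≥0 → Ω → ℝ}
    {l : Filter ι} {Y : ℝ≥0 → Ω' → ℝ} [IsProbabilityMeasure P] {P' : Measure Ω'}
    [IsProbabilityMeasure P'] (h : TendstoInLaw X l Y P P') (t : ℝ≥0) :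
    TendstoInDistribution (fun i => X i t) l (Y t) (fun _ => P) P' :=
  (h {t}).continuous_comp (g := fun x : ({t} : Finset ℝ≥0) → ℝ => x ⟨t, by simp⟩)
    (continuous_apply _)

/-- `conj (Ψ (-ξ))` is also a characteristic exponent of `μ`, so uniqueness applies. -/
theorem IsCharExponent.neg_eq_conj {μ : Measure ℝ} {Ψ : ℝ → ℂ} (h : IsCharExponent μ Ψ) (ξ : ℝ) :
    Ψ (-ξ) = (starRingEnd ℂ) (Ψ ξ) := by
  have h' : IsCharExponent μ fun ξ => (starRingEnd ℂ) (Ψ (-ξ)) :=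
    ⟨Complex.continuous_conj.comp (h.continuous.comp continuous_neg), by simp [h.zero], fun ξ => by
      rw [Complex.exp_conj, h.exp_eq, charFun_neg, Complex.conj_conj]⟩
  have := congrFun (h.unique h') (-ξ)
  rwa [neg_neg] at this

theorem IsSymmetricProcess.charFun_im_eq_zero {Y : ℝ≥0 → Ω → ℝ} (hY : IsSymmetricProcess Y P)
    (hm : ∀ t, Measurable (Y t)) (t : ℝ≥0) (ξ : ℝ) : (charFun (P.map (Y t)) ξ).im = 0 := by
  have h1 : IdentDistrib (Y t) (fun ω => -Y t ω) P P := hY.comp (measurable_pi_apply t)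
  have h2 : P.map (fun ω => -Y t ω) = (P.map (Y t)).map (fun x => -1 * x) := by
    rw [Measure.map_map (by fun_prop) (hm t)]
    congr 1
    ext ω
    simp
  have h3 : charFun (P.map (Y t)) ξ = charFun ((P.map (Y t)).map fun x => -1 * x) ξ := by
    rw [← h2, ← h1.map_eq]
  rw [charFun_map_mul, neg_mul, one_mul, charFun_neg] at h3
  exact Complex.conj_eq_iff_im.1 h3.symm

/-- A locally symmetric and self-similar Lévy process has a characteristic exponent equivalent to
that of a symmetric stable law, and its rescalings converge to that law. -/
theorem IsLevyProcess.exists_stable_limit [IsProbabilityMeasure P] (hL : IsLevyProcess L P)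
    (hLSS : IsLSS L P) {Ψ : ℝ → ℂ} (hΨ : IsCharExponent (P.map (L 1)) Ψ) :
    ∃ (α γ : ℝ) (ν : Measure ℝ) (_ : IsProbabilityMeasure ν), 0 < α ∧ 0 < γ ∧
      Tendsto (fun ξ : ℝ => Ψ ξ / ((|ξ| ^ α : ℝ) : ℂ)) (cocompact ℝ) (𝓝 (-γ : ℂ)) ∧
      (∀ ξ, charFun ν ξ = Complex.exp ((-γ * |ξ| ^ α : ℝ) : ℂ)) ∧
      TendstoInDistribution (fun (t : ℝ≥0) (ω : Ω) => (t : ℝ) ^ (-(1 / α)) * L t ω)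
        (𝓝[>] 0) (id : ℝ → ℝ) (fun _ => P) ν := by
  obtain ⟨H, ν, hν, hlaw, hsym, hnt⟩ := hLSS
  have hprob : ∀ t : ℝ≥0, IsProbabilityMeasure (ν.map fun y : ℝ≥0 → ℝ => y t) := fun t =>
    Measure.isProbabilityMeasure_map (measurable_pi_apply t).aemeasurable
  have hcf : ∀ (t a : ℝ≥0) (ξ : ℝ), charFun (P.map (rescale H L a t)) ξ =
      Complex.exp ((((t : ℝ) / a : ℝ) : ℂ) * Ψ ((a : ℝ) ^ H * ξ)) := by
    intro t a ξ
    have : P.map (rescale H L a t) = (P.map (L (t / a))).map ((a : ℝ) ^ H * ·) := by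
      rw [Measure.map_map (by fun_prop) (hL.measurable _)]
      rfl
    rw [this, charFun_map_mul, hL.charFun_eq hΨ, NNReal.coe_div]
  obtain ⟨γ, hγ, hH, hlim, hχ⟩ := exists_tendsto_div_rpow (H := H)
    (χ := fun t => charFun (ν.map fun y : ℝ≥0 → ℝ => y t)) hΨ.continuous hΨ.zero hΨ.neg_eq_conj
    (fun t => continuous_charFun) (fun t ξ => norm_charFun_le_one ξ)
    (fun t ξ => hsym.charFun_im_eq_zero (fun t => measurable_pi_apply t) t ξ)
    (fun t ξ => by
      have h1 := tendsto_charFun_of_tendstoInDistribution (hlaw.eval t) ξ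
      simp only [hcf] at h1
      refine (h1.comp tendsto_real_toNNReal_atTop).congr' ?_
      filter_upwards [eventually_ge_atTop 0] with a ha
      simp only [Function.comp_apply, Real.coe_toNNReal a ha])
    (by
      by_contra! h
      obtain ⟨t, ht⟩ := hnt
      apply ht
      have h1 : ν.map (fun y : ℝ≥0 → ℝ => y t) = Measure.dirac 0 := by
        refine Measure.ext_of_charFun (funext fun ξ => ?_)
        rw [h t ξ, charFun_dirac]
        simp
      have h2 : ∀ᵐ x ∂(ν.map fun y : ℝ≥0 → ℝ => y t), x = 0 := by
        rw [h1, ae_dirac_eq]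
        rfl
      exact ae_of_ae_map (measurable_pi_apply t).aemeasurable h2)
  refine ⟨1 / H, γ, ν.map fun y : ℝ≥0 → ℝ => y 1, hprob 1, by positivity, hγ, hlim, hχ, ?_⟩
  -- At time 1 with `a = 1 / t`, the rescaled process is `t ^ (-H) L t`, and `H = 1 / α`.
  have hinv : Tendsto (fun t : ℝ≥0 => t⁻¹) (𝓝[>] 0) atTop := tendsto_inv_nhdsGT_zero
  have h1 := (hlaw.eval 1).tendsto.comp hinv
  refine ⟨fun t => ((hL.measurable t).const_mul _).aemeasurable, aemeasurable_id, ?_⟩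
  simp only [Measure.map_id]
  refine h1.congr' ?_
  filter_upwards [self_mem_nhdsWithin] with t ht
  apply Subtype.ext
  change P.map (rescale H L t⁻¹ 1) = P.map fun ω => (t : ℝ) ^ (-(1 / (1 / H))) * L t ω
  congr 1
  ext ω
  simp only [rescale, one_div, inv_inv, NNReal.coe_inv]
  rw [Real.rpow_neg t.coe_nonneg, Real.inv_rpow t.coe_nonneg]

/-! ### Quantitative bounds on the exponent and on rescaled marginals. -/

theorem norm_one_sub_cexp_le {z : ℂ} (hz : z.re ≤ 0) : ‖1 - Complex.exp z‖ ≤ 2 * ‖z‖ := by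
  rcases le_total ‖z‖ 1 with h | h
  · rw [norm_sub_rev]
    exact Complex.norm_exp_sub_one_le h
  · refine (norm_sub_le _ _).trans ?_
    rw [norm_one, Complex.norm_exp]
    have := Real.exp_le_one_iff.2 hz
    linarith

theorem norm_le_two_mul_norm_one_sub_cexp {z : ℂ} (hz : ‖z‖ ≤ 1 / 2) :
    ‖z‖ ≤ 2 * ‖1 - Complex.exp z‖ := by
  have h1 := Complex.norm_exp_sub_one_sub_id_le (x := z) (by linarith)
  have h2 : ‖z‖ ≤ ‖Complex.exp z - 1‖ + ‖Complex.exp z - 1 - z‖ := by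
    have := norm_sub_le (Complex.exp z - 1) (Complex.exp z - 1 - z)
    rwa [sub_sub_cancel] at this
  rw [norm_sub_rev]
  nlinarith [norm_nonneg z]

/-- A finite fractional moment gives Hölder continuity of the characteristic function at `0`. -/
theorem norm_one_sub_charFun_le_rpow {μ : Measure ℝ} [IsProbabilityMeasure μ] {q : ℝ}
    (hq : 0 < q) (hq1 : q ≤ 1) (hint : Integrable (fun x => |x| ^ q) μ) (ξ : ℝ) :
    ‖1 - charFun μ ξ‖ ≤ 2 * (∫ x, |x| ^ q ∂μ) * |ξ| ^ q := by
  have hI : Integrable (fun x : ℝ => Complex.exp (ξ * x * Complex.I)) μ := by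
    refine (integrable_const (1 : ℝ)).mono' (Continuous.aestronglyMeasurable (by fun_prop)) ?_
    refine Eventually.of_forall fun x => ?_
    rw [← Complex.ofReal_mul, Complex.norm_exp_ofReal_mul_I]
  have h1 : 1 - charFun μ ξ = ∫ x, (1 - Complex.exp (ξ * x * Complex.I)) ∂μ := by
    rw [integral_sub (integrable_const _) hI, charFun_apply_real]
    simp
  rw [h1, mul_right_comm, ← integral_const_mul]
  refine norm_integral_le_of_norm_le (hint.const_mul _) (Eventually.of_forall fun x => ?_)
  have hre : ((ξ : ℂ) * x * Complex.I).re = 0 := by simp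
  have hnorm : ‖(ξ : ℂ) * x * Complex.I‖ = |ξ| * |x| := by
    rw [norm_mul, norm_mul, Complex.norm_I, mul_one, Complex.norm_real, Complex.norm_real,
      Real.norm_eq_abs, Real.norm_eq_abs]
  rw [mul_assoc (2 : ℝ), ← Real.mul_rpow (abs_nonneg _) (abs_nonneg _)]
  rcases le_total (|ξ| * |x|) 1 with h | h
  · refine (norm_one_sub_cexp_le hre.le).trans ?_
    rw [hnorm]
    gcongr
    exact Real.self_le_rpow_of_le_one (by positivity) h hq1
  · refine (norm_sub_le _ _).trans ?_
    rw [norm_one, Complex.norm_exp, hre, Real.exp_zero]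
    have := Real.one_le_rpow h hq.le
    linarith

/-- Two-sided control of a characteristic exponent by powers. -/
theorem exists_norm_exponent_le {Ψ : ℝ → ℂ} (hΨ : Continuous Ψ) (hΨ0 : Ψ 0 = 0) {α γ q C : ℝ}
    (hq : 0 < q)
    (hlim : Tendsto (fun ξ : ℝ => Ψ ξ / ((|ξ| ^ α : ℝ) : ℂ)) (cocompact ℝ) (𝓝 (-γ : ℂ)))
    (hloc : ∀ ξ, ‖1 - Complex.exp (Ψ ξ)‖ ≤ C * |ξ| ^ q) :
    ∃ K, 0 ≤ K ∧ ∀ ξ, ‖Ψ ξ‖ ≤ K * (|ξ| ^ q + |ξ| ^ α) := by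
  have hC : 0 ≤ C := by simpa using (norm_nonneg _).trans (hloc 1)
  obtain ⟨δ, hδ, hball⟩ := Metric.eventually_nhds_iff.1
    ((hΨ.norm.tendsto 0).eventually_lt_const
      (show ‖Ψ 0‖ < 1 / 2 by rw [hΨ0, norm_zero]; norm_num))
  have habs : Tendsto (fun ξ : ℝ => |ξ|) (cocompact ℝ) atTop := tendsto_norm_cocompact_atTop
  have hbig : ∀ᶠ ξ in cocompact ℝ, ‖Ψ ξ‖ ≤ (‖(-γ : ℂ)‖ + 1) * |ξ| ^ α := by
    filter_upwards [hlim.norm.eventually_le_const (lt_add_one _), habs.eventually_gt_atTop 0]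
      with ξ h1 h2
    rwa [norm_div, Complex.norm_real, Real.norm_of_nonneg (by positivity),
      div_le_iff₀ (by positivity)] at h1
  obtain ⟨R, hR⟩ := (Metric.hasBasis_cobounded_compl_closedBall (0 : ℝ)).eventually_iff.1
    (Metric.cobounded_eq_cocompact (α := ℝ) ▸ hbig)
  obtain ⟨B, hB⟩ := (isCompact_closedBall (0 : ℝ) R).exists_bound_of_continuousOn hΨ.continuousOn
  -- The three constants serve near `0` (where `Ψ` is small and `exp` can be inverted), near
  -- infinity, and on the compact range between.
  refine ⟨max (2 * C) (max (‖(-γ : ℂ)‖ + 1) (|B| * δ ^ (-q))),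
    (by positivity : (0 : ℝ) ≤ 2 * C).trans (le_max_left _ _), fun ξ => ?_⟩
  have hK1 := le_max_left (2 * C) (max (‖(-γ : ℂ)‖ + 1) (|B| * δ ^ (-q)))
  have hK2 := (le_max_left _ _).trans (le_max_right (2 * C) (max (‖(-γ : ℂ)‖ + 1) (|B| * δ ^ (-q))))
  have hK3 := (le_max_right _ _).trans
    (le_max_right (2 * C) (max (‖(-γ : ℂ)‖ + 1) (|B| * δ ^ (-q))))
  set K := max (2 * C) (max (‖(-γ : ℂ)‖ + 1) (|B| * δ ^ (-q)))
  have hK : 0 ≤ K := (by positivity : (0 : ℝ) ≤ 2 * C).trans hK1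
  have hxq : 0 ≤ |ξ| ^ q := by positivity
  have hxα : 0 ≤ |ξ| ^ α := by positivity
  rcases lt_or_ge |ξ| δ with h | h
  · have h1 := norm_le_two_mul_norm_one_sub_cexp (hball (by simpa using h)).le
    calc _ ≤ 2 * (C * |ξ| ^ q) := h1.trans (by linarith [hloc ξ])
      _ = 2 * C * |ξ| ^ q := by ring
      _ ≤ K * (|ξ| ^ q + |ξ| ^ α) := by gcongr; linarith
  · by_cases hξ : ξ ∈ Metric.closedBall (0 : ℝ) R
    · have h1 : 1 ≤ δ ^ (-q) * |ξ| ^ q := by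
        rw [Real.rpow_neg hδ.le, ← div_eq_inv_mul, one_le_div (by positivity)]
        gcongr
      calc _ ≤ |B| * 1 := by rw [mul_one]; exact (hB ξ hξ).trans (le_abs_self B)
        _ ≤ |B| * (δ ^ (-q) * |ξ| ^ q) := by gcongr
        _ = |B| * δ ^ (-q) * |ξ| ^ q := by ring
        _ ≤ K * (|ξ| ^ q + |ξ| ^ α) := by gcongr; linarith
    · calc _ ≤ (‖(-γ : ℂ)‖ + 1) * |ξ| ^ α := hR.2 hξ
        _ ≤ K * (|ξ| ^ q + |ξ| ^ α) := by gcongr; linarith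

/-- Halving `γ` leaves room for the asymptotics outside a ball; inside it only `Re Ψ ≤ 0` is known,
and `D` absorbs the power. -/
theorem exists_re_exponent_le {Ψ : ℝ → ℂ} (hre : ∀ ξ, (Ψ ξ).re ≤ 0) {α γ : ℝ} (hα : 0 < α)
    (hγ : 0 < γ)
    (hlim : Tendsto (fun ξ : ℝ => Ψ ξ / ((|ξ| ^ α : ℝ) : ℂ)) (cocompact ℝ) (𝓝 (-γ : ℂ))) :
    ∃ D, 0 ≤ D ∧ ∀ ξ, (Ψ ξ).re ≤ -(γ / 2) * |ξ| ^ α + D := by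
  have habs : Tendsto (fun ξ : ℝ => |ξ|) (cocompact ℝ) atTop := tendsto_norm_cocompact_atTop
  have h1 := (Complex.continuous_re.tendsto _).comp hlim
  rw [Complex.neg_re, Complex.ofReal_re] at h1
  have hbig : ∀ᶠ ξ in cocompact ℝ, (Ψ ξ).re ≤ -(γ / 2) * |ξ| ^ α := by
    filter_upwards [h1.eventually_le_const (show -γ < -(γ / 2) by linarith),
      habs.eventually_gt_atTop 0] with ξ h1 h2
    simp only [Function.comp_apply, Complex.div_ofReal_re] at h1
    rwa [div_le_iff₀ (by positivity)] at h1
  obtain ⟨R, hR⟩ := (Metric.hasBasis_cobounded_compl_closedBall (0 : ℝ)).eventually_iff.1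
    (Metric.cobounded_eq_cocompact (α := ℝ) ▸ hbig)
  refine ⟨γ / 2 * |R| ^ α, by positivity, fun ξ => ?_⟩
  by_cases hξ : ξ ∈ Metric.closedBall (0 : ℝ) R
  · have h2 : |ξ| ≤ |R| := (by simpa using hξ : |ξ| ≤ R).trans (le_abs_self R)
    have h3 : |ξ| ^ α ≤ |R| ^ α := by gcongr
    have := mul_le_mul_of_nonneg_left h3 (by positivity : 0 ≤ γ / 2)
    linarith [hre ξ]
  · have : 0 ≤ γ / 2 * |R| ^ α := by positivity
    linarith [hR.2 hξ]

theorem integrable_exp_neg_mul_abs_rpow {b α : ℝ} (hb : 0 < b) (hα : 0 < α) :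
    Integrable fun x : ℝ => Real.exp (-b * |x| ^ α) := by
  have h0 : IntegrableOn (fun x : ℝ => Real.exp (-b * |x| ^ α)) (Set.Ioi 0) := by
    refine (integrableOn_rpow_mul_exp_neg_mul_rpow (s := 0) (by norm_num) hα hb).congr_fun
      (fun x hx => ?_) measurableSet_Ioi
    have hx' : 0 < x := hx
    simp [abs_of_pos hx']
  have h1 : IntegrableOn (fun x : ℝ => Real.exp (-b * |x| ^ α)) (Set.Iic 0) := by
    have h2 : IntegrableOn (fun x : ℝ => Real.exp (-b * |x| ^ α)) (Set.Ici (-0)) := by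
      rwa [neg_zero, integrableOn_Ici_iff_integrableOn_Ioi]
    have := h2.comp_neg_Iic
    simpa using this
  have := h1.union h0
  rwa [Set.Iic_union_Ioi, integrableOn_univ] at this

/-- Uniform characteristic function bounds for rescaled marginals of a Lévy process. -/
theorem charFunBound_of_exponent {Ψ : ℝ → ℂ} {α γ q K D : ℝ} (hα : 0 < α)
    (hqα : q ≤ α) (hγ : 0 < γ) (hK0 : 0 ≤ K) (hD0 : 0 ≤ D) (hre0 : ∀ ξ, (Ψ ξ).re ≤ 0)
    (hK : ∀ ξ, ‖Ψ ξ‖ ≤ K * (|ξ| ^ q + |ξ| ^ α)) (hD : ∀ ξ, (Ψ ξ).re ≤ -(γ / 2) * |ξ| ^ α + D)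
    -- `c` is the spatial scaling. The bounds depend on `t` and `c` only through `T` and `τ`, so
    -- they are uniform when these are fixed.
    {t c T τ : ℝ} (ht : 0 ≤ t) (hc : 0 ≤ c) (htT : t ≤ T) (htq : t * c ^ q ≤ T)
    (htα : t * c ^ α ≤ T) (hτ : τ ≤ t * c ^ α) {μ : Measure ℝ}
    (hμ : ∀ ξ, charFun μ ξ = Complex.exp ((t : ℂ) * Ψ (c * ξ))) :
    CharFunBound (fun ξ => Real.exp (T * D) * Real.exp (-(γ / 2 * τ) * |ξ| ^ α))
      (2 * K * T * (1 + 2 ^ (α - q))) q μ := by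
  refine ⟨fun ξ => ?_, fun ξ hξ => ?_⟩
  · rw [hμ, Complex.norm_exp, Complex.re_ofReal_mul, ← Real.exp_add]
    apply Real.exp_le_exp.2
    have h1 : |c * ξ| ^ α = c ^ α * |ξ| ^ α := by
      rw [abs_mul, abs_of_nonneg hc, Real.mul_rpow hc (abs_nonneg _)]
    have h2 := mul_le_mul_of_nonneg_left (hD (c * ξ)) ht
    rw [h1] at h2
    have h3 : t * D ≤ T * D := by gcongr
    have h4 : γ / 2 * τ * |ξ| ^ α ≤ γ / 2 * (t * c ^ α) * |ξ| ^ α := by gcongr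
    linarith
  · have hT : 0 ≤ T := ht.trans htT
    rw [hμ]
    refine (norm_one_sub_cexp_le ?_).trans ?_
    · rw [Complex.re_ofReal_mul]
      exact mul_nonpos_of_nonneg_of_nonpos ht (hre0 _)
    rw [norm_mul, Complex.norm_real, Real.norm_of_nonneg ht]
    have h1 : ∀ r : ℝ, |c * ξ| ^ r = c ^ r * |ξ| ^ r := fun r => by
      rw [abs_mul, abs_of_nonneg hc, Real.mul_rpow hc (abs_nonneg _)]
    have h2 := mul_le_mul_of_nonneg_left (hK (c * ξ)) ht
    rw [h1, h1] at h2
    -- Since `|ξ| ≤ 2` and `q ≤ α`, the larger power is absorbed into the smaller one.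
    have h3 : |ξ| ^ α ≤ 2 ^ (α - q) * |ξ| ^ q := by
      rcases eq_or_lt_of_le (abs_nonneg ξ) with h0 | h0
      · rw [← h0, Real.zero_rpow hα.ne']
        positivity
      · rw [← sub_add_cancel α q, Real.rpow_add h0, sub_add_cancel]
        gcongr
    calc _ ≤ 2 * (t * (K * (c ^ q * |ξ| ^ q + c ^ α * |ξ| ^ α))) := by gcongr
      _ = 2 * K * ((t * c ^ q) * |ξ| ^ q + (t * c ^ α) * |ξ| ^ α) := by ring
      _ ≤ 2 * K * (T * |ξ| ^ q + T * (2 ^ (α - q) * |ξ| ^ q)) := by gcongr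
      _ = _ := by ring

/-- The bounds are closed under pointwise limits, so the stable law inherits them from the rescaled
marginals. -/
theorem CharFunBound.of_tendsto {ι : Type*} {l : Filter ι} [l.NeBot] {G : ℝ → ℝ} {C p : ℝ}
    {μ : ι → Measure ℝ} {ν : Measure ℝ} (hμ : ∀ᶠ i in l, CharFunBound G C p (μ i))
    (hlim : ∀ ξ, Tendsto (fun i => charFun (μ i) ξ) l (𝓝 (charFun ν ξ))) :
    CharFunBound G C p ν :=
  ⟨fun ξ => le_of_tendsto (hlim ξ).norm (hμ.mono fun _ hi => hi.norm_le ξ),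
    fun ξ hξ => le_of_tendsto ((hlim ξ).const_sub 1).norm
      (hμ.mono fun _ hi => hi.norm_one_sub_le ξ hξ)⟩

/-- Without an exponent, `charExponent` defaults to `0`, every `p > 0` is admissible and the infimum
is `0`. A positive index therefore supplies `Ψ`. -/
theorem exists_isCharExponent_of_bgIndex_ne_zero (h : bgIndex L P ≠ 0) :
    ∃ Ψ, IsCharExponent (P.map (L 1)) Ψ := by
  by_contra hex
  apply h
  rw [bgIndex, charExponent, dif_neg hex]
  suffices {p : ℝ | 0 < p ∧
      Tendsto (fun ξ : ℝ => ‖(0 : ℝ → ℂ) ξ‖ / |ξ| ^ p) (cocompact ℝ) (𝓝 0)} = Set.Ioi 0 by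
    rw [this, csInf_Ioi]
  ext p
  simp

end LevyEntropy

/-! ### The main theorem. -/

theorem theorem4p1 {Ω : Type*} [MeasurableSpace Ω] (P : Measure Ω) [IsProbabilityMeasure P]
    (L : ℝ≥0 → Ω → ℝ) (hL : LevyEntropy.IsLevyProcess L P) (hLSS : LevyEntropy.IsLSS L P)
    (β : ℝ) (hβ : β ∈ Set.Ioc (0 : ℝ) 2) (hindex : LevyEntropy.bgIndex L P = β)
    (hmoment : ∃ p : ℝ, 0 < p ∧ Integrable (fun ω => |L 1 ω| ^ p) P) :
    (∀ t : ℝ≥0, 0 < t → LevyEntropy.HasFiniteDiffEntropy (P.map (L t))) ∧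
    ∃ (γ : ℝ) (ν : Measure ℝ) (_ : IsProbabilityMeasure ν),
      LevyEntropy.IsSymmetricStable β γ ν ∧
      TendstoInDistribution (fun (t : ℝ≥0) (ω : Ω) => (t : ℝ) ^ (-(1 / β)) * L t ω)
        (𝓝[>] 0) (id : ℝ → ℝ) (fun _ => P) ν ∧
      LevyEntropy.HasFiniteDiffEntropy ν ∧
      Tendsto (fun t : ℝ≥0 =>
          LevyEntropy.diffEntropy (P.map (L t)) - 1 / β * Real.log (t : ℝ))
        (𝓝[>] 0) (𝓝 (LevyEntropy.diffEntropy ν)) := by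
  open LevyEntropy in
  have hβ0 : 0 < β := hβ.1
  obtain ⟨Ψ, hΨ⟩ := exists_isCharExponent_of_bgIndex_ne_zero (hindex ▸ hβ0.ne')
  obtain ⟨α, γ, ν, hν, hα, hγ, hlim, hcfν, hdist⟩ := hL.exists_stable_limit hLSS hΨ
  obtain rfl : α = β := by
    rw [← hindex, bgIndex, hΨ.charExponent_eq]
    exact (sInf_growth_eq hα hγ hlim).symm
  have hprob : ∀ t, IsProbabilityMeasure (P.map (L t)) := fun t =>
    Measure.isProbabilityMeasure_map (hL.measurable t).aemeasurable
  have hre0 : ∀ ξ, (Ψ ξ).re ≤ 0 := fun ξ => by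
    have := norm_charFun_le_one (μ := P.map (L 1)) ξ
    rwa [← hΨ.exp_eq, Complex.norm_exp, Real.exp_le_one_iff] at this
  obtain ⟨p, hp, hpint⟩ := hmoment
  -- `q ≤ p` for the moment, `q ≤ 1` for the Hölder bound at `0`, and `q ≤ α` so that `t * t ^ (-q /
  -- α) ≤ 1` for small `t`.
  set q : ℝ := min p (min 1 α)
  have hq : 0 < q := lt_min hp (lt_min one_pos hα)
  have hqα : q ≤ α := (min_le_right _ _).trans (min_le_right _ _)
  have hqint : Integrable (fun x : ℝ => |x| ^ q) (P.map (L 1)) := by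
    rw [integrable_map_measure (Measurable.aestronglyMeasurable (by fun_prop))
      (hL.measurable 1).aemeasurable]
    refine ((integrable_const (1 : ℝ)).add hpint).mono' ?_ (Eventually.of_forall fun ω => ?_)
    · have := hL.measurable 1
      exact Measurable.aestronglyMeasurable (by fun_prop)
    · simp only [Function.comp_apply, Pi.add_apply]
      rw [Real.norm_of_nonneg (by positivity)]
      rcases le_total |L 1 ω| 1 with h | h
      · have h1 := Real.rpow_le_one (abs_nonneg _) h hq.le
        have h2 : 0 ≤ |L 1 ω| ^ p := by positivity
        linarith
      · have := Real.rpow_le_rpow_of_exponent_le h (min_le_left p (min 1 α))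
        linarith
  obtain ⟨K, hK0, hK⟩ := exists_norm_exponent_le hΨ.continuous hΨ.zero hq hlim fun ξ => by
    rw [hΨ.exp_eq]
    exact norm_one_sub_charFun_le_rpow hq ((min_le_right _ _).trans (min_le_left _ _)) hqint ξ
  obtain ⟨D, hD0, hD⟩ := exists_re_exponent_le hre0 hα hγ hlim
  have hG : ∀ T τ : ℝ, 0 < τ → Integrable fun ξ : ℝ =>
      Real.exp (T * D) * Real.exp (-(γ / 2 * τ) * |ξ| ^ α) := fun T τ hτ =>
    (integrable_exp_neg_mul_abs_rpow (by positivity) hα).const_mul _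
  have hcfL := hL.charFun_eq hΨ
  have hbL : ∀ t : ℝ≥0, CharFunBound _ _ q (P.map (L t)) := fun t =>
    charFunBound_of_exponent (t := t) (c := 1) (T := t) (τ := t) hα hqα hγ hK0 hD0 hre0 hK hD
      t.coe_nonneg zero_le_one le_rfl (by simp) (by simp) (by simp) (fun ξ => by
        rw [hcfL, one_mul])
  have hfin : ∀ t : ℝ≥0, 0 < t → HasFiniteDiffEntropy (P.map (L t)) := fun t ht =>
    (hbL t).hasFiniteDiffEntropy (hG _ _ ht) hq
  refine ⟨hfin, γ, ν, hν, ⟨hν, hα, hβ.2, hγ, hcfν⟩, hdist, ?_⟩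
  set X : ℝ≥0 → Measure ℝ := fun t => (P.map (L t)).map ((t : ℝ) ^ (-(1 / α)) * ·)
  have hX : ∀ t, IsProbabilityMeasure (X t) := fun t =>
    Measure.isProbabilityMeasure_map (by fun_prop)
  have hXlim : ∀ ξ, Tendsto (fun t => charFun (X t) ξ) (𝓝[>] 0) (𝓝 (charFun ν ξ)) := by
    intro ξ
    have h1 := tendsto_charFun_of_tendstoInDistribution hdist ξ
    rw [Measure.map_id] at h1
    refine h1.congr fun t => ?_
    simp only [X]
    rw [Measure.map_map (by fun_prop) (hL.measurable t)]
    rfl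
  -- With `c = t ^ (-1 / α)` one has `t c ^ α = 1`, so `T = τ = 1` works for all `0 < t ≤ 1`.
  have hXb : ∀ᶠ t in 𝓝[>] (0 : ℝ≥0), CharFunBound
      (fun ξ => Real.exp (1 * D) * Real.exp (-(γ / 2 * 1) * |ξ| ^ α))
      (2 * K * 1 * (1 + 2 ^ (α - q))) q (X t) := by
    filter_upwards [self_mem_nhdsWithin, nhdsWithin_le_nhds (Iic_mem_nhds one_pos)] with t ht ht1
    have ht0 : (0 : ℝ) < t := ht
    have ht1' : (t : ℝ) ≤ 1 := ht1
    have htα : (t : ℝ) * ((t : ℝ) ^ (-(1 / α))) ^ α = 1 := by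
      rw [← Real.rpow_mul ht0.le, neg_mul, one_div_mul_cancel hα.ne', Real.rpow_neg_one,
        mul_inv_cancel₀ ht0.ne']
    refine charFunBound_of_exponent (t := t) (c := (t : ℝ) ^ (-(1 / α))) (T := 1) (τ := 1)
      hα hqα hγ hK0 hD0 hre0 hK hD ht0.le (by positivity) ht1' ?_ htα.le htα.ge fun ξ => ?_
    · rw [← Real.rpow_mul ht0.le]
      nth_rewrite 1 [← Real.rpow_one (t : ℝ)]
      rw [← Real.rpow_add ht0]
      refine Real.rpow_le_one ht0.le ht1' ?_
      have : q / α ≤ 1 := (div_le_one hα).2 hqα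
      have h2 : 1 + -(1 / α) * q = 1 - q / α := by ring
      linarith
    · simp only [X]
      rw [charFun_map_mul, hcfL]
  have hνb := CharFunBound.of_tendsto hXb hXlim
  refine ⟨hνb.hasFiniteDiffEntropy (hG _ _ one_pos) hq, ?_⟩
  refine (tendsto_diffEntropy (hG _ _ one_pos) hq hXb hνb hXlim).congr' ?_
  filter_upwards [self_mem_nhdsWithin] with t ht
  have ht0 : (0 : ℝ) < t := ht
  rw [diffEntropy_map_mul ((hbL t).integrable (hG _ _ ht0)) (hfin t ht) (by positivity),
    Real.log_rpow ht0]
  ring
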